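/- Let $\mathbb U$ be the open unit disc and $H^2$ the Hilbert space of holomorphic functions $f(z)=\sum_{n\ge0}\hat f(n)z^n$ on $\mathbb U$ with $\|f\|^2=\sum_n|\hat f(n)|^2<\infty$. For a holomorphic selfmap $\psi$ of $\mathbb U$ let $C_\psi f=f\circ\psi$, for a bounded holomorphic function $g$ on $\mathbb U$ let $M_gf=gf$, and let $B$ be the backward shift, $(Bf)(z)=(f(z)-f(0))/z$ for $z\ne0$, $(Bf)(0)=f'(0)$; these are bounded operators on $H^2$. Let $\varphi$ be a rational function with $\varphi(\mathbb U)\subset\mathbb U$, viewed as a map of the Riemann sphere $\hat{\mathbb C}$, and let $\varphi_e=\rho\circ\varphi\circ\rho$ with $\rho(z)=1/\overline z$. A point $w\in\hat{\mathbb C}$ is a regular value of $\varphi$ if $\varphi^{-1}(\{w\})$ has exactly $\deg\varphi$ distinct points, and a critical value otherwise. Call $\varphi$ outer regular if all its critical values lie in $\mathbb U$, and strongly outer regular if in addition $\varphi(\infty)\in\mathbb U$. A branch of $\varphi_e^{-1}$ on $\mathbb U$ is the inverse of a restriction of $\varphi_e$ to a set which $\varphi_e$ maps one-to-one onto $\mathbb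 U$. Suppose $\varphi$ is outer regular and exactly one point of $\partial\mathbb U$ is mapped by $\varphi$ into $\partial\mathbb U$. Then there is a holomorphic selfmap $\sigma$ of $\mathbb U$ that is a branch of $\varphi_e^{-1}$ on $\mathbb U$ such that: (a) the function $h(z)=z\sigma'(z)$ is holomorphic and bounded on $\mathbb U$, and $C_\varphi^*-M_hC_\sigma B$ is a compact operator on $H^2$; (b) if $\varphi$ is strongly outer regular, then, for the same $\sigma$, $\sigma$ has no zero in $\mathbb U$, the function $g(z)=z\sigma'(z)/\sigma(z)$ is holomorphic and bounded on $\mathbb U$, and $C_\varphi^*-M_gC_\sigma$ is a compact operator on $H^2$. -/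

import Mathlib

open scoped ComplexConjugate InnerProductSpace
open Metric Set

noncomputable section

namespace AdjointComp

/-- The open unit disc of the complex plane. -/
abbrev unitDisc : Set ℂ := ball (0 : ℂ) 1

/-! ### The Hardy space -/

/-- The `n`-th Maclaurin coefficient of `f`. -/
def macCoeff (f : ℂ → ℂ) (n : ℕ) : ℂ := iteratedDeriv n f 0 / (n.factorial : ℂ)

/-- Functions holomorphic on the unit disc (normalised to be `0` off the disc, so that functions
on the disc are represented uniquely) with square-summable Maclaurin coefficients. -/
def IsHardy (f : ℂ → ℂ) : Prop :=
  DifferentiableOn ℂ f unitDisc ∧ (∀ z ∉ unitDisc, f z = 0) ∧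
    Summable fun n => ‖macCoeff f n‖ ^ 2

theorem contDiffAt_zero {f : ℂ → ℂ} (hf : DifferentiableOn ℂ f unitDisc) (n : ℕ) :
    ContDiffAt ℂ n f 0 :=
  (hf.analyticAt (ball_mem_nhds 0 one_pos)).contDiffAt

theorem macCoeff_add {f g : ℂ → ℂ} (hf : DifferentiableOn ℂ f unitDisc)
    (hg : DifferentiableOn ℂ g unitDisc) (n : ℕ) :
    macCoeff (f + g) n = macCoeff f n + macCoeff g n := by
  unfold macCoeff
  rw [iteratedDeriv_add (contDiffAt_zero hf n) (contDiffAt_zero hg n), add_div]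

theorem macCoeff_smul {f : ℂ → ℂ} (c : ℂ) (hf : DifferentiableOn ℂ f unitDisc) (n : ℕ) :
    macCoeff (c • f) n = c * macCoeff f n := by
  unfold macCoeff
  rw [iteratedDeriv_const_smul (contDiffAt_zero hf n), smul_eq_mul, mul_div_assoc]

theorem memlp_two_iff {a : ℕ → ℂ} : Memℓp a 2 ↔ Summable fun n => ‖a n‖ ^ 2 := by
  rw [memℓp_gen_iff (by norm_num)]
  simp

/-- The Hardy space as a linear space of functions. -/
def hardySubmodule : Submodule ℂ (ℂ → ℂ) where
  carrier := {f | IsHardy f}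
  zero_mem' := by
    refine ⟨differentiableOn_const 0, fun _ _ => rfl, ?_⟩
    have : ∀ n, macCoeff 0 n = 0 := fun n => by
      have := macCoeff_smul (f := 0) 0 (differentiableOn_const 0) n
      simpa using this
    simp [this]
  add_mem' := by
    rintro f g ⟨hf, hf0, hfs⟩ ⟨hg, hg0, hgs⟩
    refine ⟨hf.add hg, fun z hz => by simp [hf0 z hz, hg0 z hz], ?_⟩
    have := (memlp_two_iff.2 hfs).add (memlp_two_iff.2 hgs)
    have h2 := memlp_two_iff.1 this
    simpa [macCoeff_add hf hg] using h2
  smul_mem' := by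
    rintro c f ⟨hf, hf0, hfs⟩
    refine ⟨hf.const_smul c, fun z hz => by simp [hf0 z hz], ?_⟩
    simpa [macCoeff_smul c hf, mul_pow] using hfs.mul_left (‖c‖ ^ 2)

/-- The Hardy space `H²` of the unit disc. -/
def H2 : Type := hardySubmodule

instance : AddCommGroup H2 := inferInstanceAs (AddCommGroup hardySubmodule)
instance : Module ℂ H2 := inferInstanceAs (Module ℂ hardySubmodule)
instance : CoeFun H2 (fun _ => ℂ → ℂ) := ⟨fun f => f.1⟩

/-- The sequence of Maclaurin coefficients, as a linear map into `ℓ²`. -/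
def coeffs : H2 →ₗ[ℂ] lp (fun _ : ℕ => ℂ) 2 where
  toFun f := ⟨macCoeff f, memlp_two_iff.2 f.2.2.2⟩
  map_add' f g := by
    ext n
    exact macCoeff_add f.2.1 g.2.1 n
  map_smul' c f := by
    ext n
    exact macCoeff_smul c f.2.1 n

theorem coeffs_apply (f : H2) (n : ℕ) : coeffs f n = macCoeff f n := rfl

theorem hasSum_maclaurin (f : H2) {z : ℂ} (hz : z ∈ unitDisc) :
    HasSum (fun n => macCoeff f n * z ^ n) (f z) := by
  have h := Complex.hasSum_taylorSeries_on_ball f.2.1 hz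
  have e : (fun n => macCoeff f n * z ^ n) =
      fun n => ((n.factorial : ℂ)⁻¹ • (z - 0) ^ n • iteratedDeriv n f 0 : ℂ) := by
    funext n
    simp only [macCoeff, sub_zero, smul_eq_mul]
    ring
  rw [e]
  exact h

theorem coeffs_injective : Function.Injective coeffs := by
  intro f g h
  apply Subtype.ext
  funext z
  by_cases hz : z ∈ unitDisc
  · refine (hasSum_maclaurin f hz).unique ?_
    have hfg : ∀ n, macCoeff f n = macCoeff g n := fun n => by
      rw [← coeffs_apply, ← coeffs_apply, h]
    simp only [hfg]
    exact hasSum_maclaurin g hz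
  · rw [f.2.2.1 z hz, g.2.2.1 z hz]

theorem coeffs_surjective : Function.Surjective coeffs := by
  intro a
  let p := FormalMultilinearSeries.ofScalars ℂ (fun n => a n)
  have hr : (1 : ENNReal) ≤ p.radius := by
    have := p.le_radius_of_bound ‖a‖ (r := 1) fun n => by
      simpa [p] using lp.norm_apply_le_norm (by norm_num) a n
    simpa using this
  have hp : HasFPowerSeriesOnBall p.sum p 0 1 :=
    (p.hasFPowerSeriesOnBall (one_pos.trans_le hr)).mono one_pos hr
  let f : ℂ → ℂ := unitDisc.indicator p.sum
  have hball : eball (0 : ℂ) 1 = unitDisc := by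
    simpa using eball_ofReal (x := (0 : ℂ)) (ε := 1)
  have hdiff : DifferentiableOn ℂ f unitDisc := by
    have h := hp.differentiableOn
    rw [hball] at h
    exact h.congr fun z hz => indicator_of_mem hz _
  have hfp : HasFPowerSeriesAt f p 0 := by
    refine hp.hasFPowerSeriesAt.congr ?_
    filter_upwards [ball_mem_nhds (0 : ℂ) one_pos] with z hz
    exact (indicator_of_mem hz _).symm
  have hco : ∀ n, macCoeff f n = a n := by
    have h2 := (hdiff.analyticAt (ball_mem_nhds 0 one_pos)).hasFPowerSeriesAt
    have h3 := hfp.eq_formalMultilinearSeries h2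
    intro n
    have h4 := congrArg (fun q : FormalMultilinearSeries ℂ ℂ ℂ => q n fun _ => 1) h3
    simp only [p, FormalMultilinearSeries.ofScalars_apply_eq] at h4
    simpa [macCoeff] using h4.symm
  refine ⟨⟨f, hdiff, fun z hz => indicator_of_notMem hz _, ?_⟩, ?_⟩
  · simp only [hco]
    exact memlp_two_iff.1 a.2
  · ext n
    exact hco n

/-- `‖f‖² = ∑ |f̂(n)|²`. -/
instance : NormedAddCommGroup H2 := NormedAddCommGroup.induced H2 _ coeffs coeffs_injective

/-- `⟪f, g⟫ = ∑ conj (f̂(n)) * ĝ(n)`; the first slot is the conjugate-linear one. -/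
instance : InnerProductSpace ℂ H2 where
  norm_smul_le c f := by
    change ‖coeffs (c • f)‖ ≤ ‖c‖ * ‖coeffs f‖
    rw [map_smul, norm_smul]
  inner f g := ⟪coeffs f, coeffs g⟫_ℂ
  norm_sq_eq_re_inner f := norm_sq_eq_re_inner (𝕜 := ℂ) (coeffs f)
  conj_inner_symm f g := inner_conj_symm (coeffs f) (coeffs g)
  add_left f g h := by
    change ⟪coeffs (f + g), coeffs h⟫_ℂ = ⟪coeffs f, coeffs h⟫_ℂ + ⟪coeffs g, coeffs h⟫_ℂ
    rw [map_add, inner_add_left]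
  smul_left f g c := by
    change ⟪coeffs (c • f), coeffs g⟫_ℂ = conj c * ⟪coeffs f, coeffs g⟫_ℂ
    rw [map_smul, inner_smul_left]

/-- The Hardy space is isometrically isomorphic to `ℓ²` through Maclaurin coefficients. -/
def coeffEquiv : H2 ≃ₗᵢ[ℂ] lp (fun _ : ℕ => ℂ) 2 where
  toLinearEquiv := LinearEquiv.ofBijective coeffs ⟨coeffs_injective, coeffs_surjective⟩
  norm_map' _ := rfl

instance : CompleteSpace H2 :=
  (completeSpace_congr (e := coeffEquiv.toLinearEquiv.toEquiv)
    coeffEquiv.isometry.isUniformEmbedding).2 inferInstance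

/-! ### Operators on the Hardy space -/

/-- `T` is the composition operator `C_ψ : f ↦ f ∘ ψ`. -/
def IsCompositionOp (ψ : ℂ → ℂ) (T : H2 →L[ℂ] H2) : Prop :=
  ∀ f : H2, ∀ z ∈ unitDisc, T f z = f (ψ z)

/-- `T` is the multiplication operator `M_g : f ↦ g f`. -/
def IsMultiplicationOp (g : ℂ → ℂ) (T : H2 →L[ℂ] H2) : Prop :=
  ∀ f : H2, ∀ z ∈ unitDisc, T f z = g z * f z

/-- `T` is the backward shift: `(T f)(z) = (f z - f 0) / z` for `z ≠ 0` in the disc, and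
`(T f)(0) = f'(0)`. -/
def IsBackwardShift (T : H2 →L[ℂ] H2) : Prop :=
  ∀ f : H2, ∀ z ∈ unitDisc, T f z = if z = 0 then deriv f 0 else (f z - f 0) / z

/-- `g` is holomorphic and bounded on the unit disc. -/
def IsBoundedHolomorphic (g : ℂ → ℂ) : Prop :=
  DifferentiableOn ℂ g unitDisc ∧ ∃ M : ℝ, ∀ z ∈ unitDisc, ‖g z‖ ≤ M

/-! ### Rational functions on the Riemann sphere -/

/-- The value at `∞` of a rational function. -/
def valueAtInfty (φ : RatFunc ℂ) : OnePoint ℂ :=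
  if φ.denom.natDegree < φ.num.natDegree then OnePoint.infty
  else ((φ.num.coeff φ.denom.natDegree / φ.denom.leadingCoeff : ℂ) : OnePoint ℂ)

open Classical in
/-- A rational function as a map of the Riemann sphere to itself. The polynomials `φ.num` and
`φ.denom` are relatively prime, so that the poles are the zeros of `φ.denom`. -/
def sphereMap (φ : RatFunc ℂ) (x : OnePoint ℂ) : OnePoint ℂ :=
  x.elim (valueAtInfty φ) fun z =>
    if φ.denom.eval z = 0 then OnePoint.infty
    else ((φ.eval (RingHom.id ℂ) z : ℂ) : OnePoint ℂ)

/-- The unit disc as a subset of the Riemann sphere. -/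
def sphereDisc : Set (OnePoint ℂ) := (fun z : ℂ => (z : OnePoint ℂ)) '' unitDisc

/-- The unit circle as a subset of the Riemann sphere. -/
def sphereCircle : Set (OnePoint ℂ) := (fun z : ℂ => (z : OnePoint ℂ)) '' sphere 0 1

/-- The rational function `φ` maps the unit disc into itself. -/
def IsRatSelfMap (φ : RatFunc ℂ) : Prop := MapsTo (sphereMap φ) sphereDisc sphereDisc

/-- The degree of a rational function: the larger of the degrees of numerator and denominator in
lowest terms. -/
def ratDegree (φ : RatFunc ℂ) : ℕ := max φ.num.natDegree φ.denom.natDegree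

/-- `w` is a regular value of `φ`: it has exactly `deg φ` distinct preimages on the sphere. -/
def IsRegularValue (φ : RatFunc ℂ) (w : OnePoint ℂ) : Prop :=
  (sphereMap φ ⁻¹' {w}).encard = ratDegree φ

/-- All critical (that is, non-regular) values of `φ` lie in the open unit disc. -/
def IsOuterRegular (φ : RatFunc ℂ) : Prop :=
  ∀ w : OnePoint ℂ, ¬ IsRegularValue φ w → w ∈ sphereDisc

/-- Outer regular, and the value at `∞` lies in the open unit disc. -/
def IsStronglyOuterRegular (φ : RatFunc ℂ) : Prop :=
  IsOuterRegular φ ∧ sphereMap φ OnePoint.infty ∈ sphereDisc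

open Classical in
/-- Inversion `z ↦ 1 / conj z` in the unit circle, exchanging `0` and `∞`. -/
def circleInv (x : OnePoint ℂ) : OnePoint ℂ :=
  x.elim ((0 : ℂ) : OnePoint ℂ) fun z =>
    if z = 0 then OnePoint.infty else ((1 / conj z : ℂ) : OnePoint ℂ)

/-- The exterior map `φ_e = ρ ∘ φ ∘ ρ`. -/
def exteriorMap (φ : RatFunc ℂ) : OnePoint ℂ → OnePoint ℂ :=
  circleInv ∘ sphereMap φ ∘ circleInv

/-- `σ` is a branch of `F⁻¹` on `Ω`: the inverse of the restriction of `F` to a set `V` on which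
`F` is one-to-one and whose image is `Ω`. -/
def IsInverseBranch (F : OnePoint ℂ → OnePoint ℂ) (σ : ℂ → ℂ) (Ω : Set ℂ) : Prop :=
  ∃ V : Set (OnePoint ℂ), InjOn F V ∧ F '' V = (fun z : ℂ => (z : OnePoint ℂ)) '' Ω ∧
    ∀ z ∈ Ω, (σ z : OnePoint ℂ) ∈ V ∧ F (σ z) = z

end AdjointComp

end

noncomputable section

namespace AdjointComp

open Filter Topology

/-! ### Parseval's identity and norms in the Hardy space -/

/-! Write `φ = p/q` in lowest terms, `d = deg φ`, and let `F = N/D` be the exterior map, where `N`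
and `D` are the conjugate reversals of `q` and `p`. For `z` in the disc with kernel `k_z`, the value
at `z` of the adjoint applied to `w^(n+1)` is the conjugate of a Taylor coefficient of `k_z ∘ φ`.
The conjugate of `k_z(φ(w))` is the rational function `N/(N - zD)` at `1/conj w`. Outer regularity
makes the fibre of `F` over each `z` in the closed disc consist of `d` distinct points of the plane,
so all poles are simple, and partial fractions give the exact formula `(C_φ^* w^(n+1))(z) = ∑
(F/F')(u) u^n`, summed over `F(u) = z` (`hasSum_kernel_comp`, `adjoint_monom_apply`).

All these fibres lie in the closed disc, and a fibre point on the circle must be the unique contact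
point `ζ`. Over the closed disc `F` is a local homeomorphism with compact domain, hence a covering,
so an inverse branch `σ` passes through `ζ` (`exists_continuousOn_branch`). The fibre points off `σ`
form a compact set (`isCompact_off_branch`) that misses the circle, so they satisfy `|u| ≤ r < 1`
(`exists_radius`).

Since `F ∘ σ = id`, the weight `F/F'` at `σ(z)` is `zσ'(z)`; the term `u = σ(z)` is therefore `M_h
C_σ B` applied to `w^(n+1)`. The other terms are `O(r^n)` uniformly in `z`, so the difference has
summable norms on the monomials and is compact (`isCompactOperator_of_summable`). In the strongly
outer regular case `0` lies in none of these fibres, so `1/u` is bounded on them and `hσ^n =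
gσ^(n+1)` turns the first form into the second.

Boundedness of the operators comes from Parseval for multipliers, and from an orthogonality argument
for composition operators (`norm_sum_smul_pow_apply_sq_le`). -/

theorem zero_mem_unitDisc : (0 : ℂ) ∈ unitDisc := mem_ball_self one_pos

theorem macCoeff_congr {f g : ℂ → ℂ} (h : EqOn f g unitDisc) (n : ℕ) :
    macCoeff f n = macCoeff g n := by
  have : f =ᶠ[𝓝 0] g := by
    filter_upwards [ball_mem_nhds (0 : ℂ) one_pos] with z hz using h hz
  rw [macCoeff, macCoeff, this.iteratedDeriv_eq]

theorem macCoeff_zero (f : ℂ → ℂ) : macCoeff f 0 = f 0 := by simp [macCoeff]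

theorem macCoeff_one (f : ℂ → ℂ) : macCoeff f 1 = deriv f 0 := by simp [macCoeff]

theorem hasSum_macCoeff {f : ℂ → ℂ} (hf : DifferentiableOn ℂ f unitDisc) {z : ℂ}
    (hz : z ∈ unitDisc) : HasSum (fun n => macCoeff f n * z ^ n) (f z) := by
  have h := Complex.hasSum_taylorSeries_on_ball hf hz
  have e : (fun n => macCoeff f n * z ^ n) =
      fun n => ((n.factorial : ℂ)⁻¹ • (z - 0) ^ n • iteratedDeriv n f 0 : ℂ) := by
    funext n
    simp only [macCoeff, sub_zero, smul_eq_mul]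
    ring
  rw [e]
  exact h

theorem macCoeff_eq_of_hasSum {f : ℂ → ℂ} {a : ℕ → ℂ}
    (h : ∀ z ∈ unitDisc, HasSum (fun n => a n * z ^ n) (f z)) (n : ℕ) : macCoeff f n = a n := by
  have hp : HasFPowerSeriesAt f (FormalMultilinearSeries.ofScalars ℂ a) 0 := by
    rw [hasFPowerSeriesAt_iff]
    filter_upwards [ball_mem_nhds (0 : ℂ) one_pos] with z hz
    simpa [mul_comm] using h z hz
  have h3 := hp.eq_formalMultilinearSeries hp.analyticAt.hasFPowerSeriesAt
  have h4 := congrArg (fun q : FormalMultilinearSeries ℂ ℂ ℂ => q n fun _ => 1) h3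
  simp only [FormalMultilinearSeries.ofScalars_apply_eq] at h4
  simpa [macCoeff] using h4.symm

theorem summable_norm_macCoeff_mul_pow {f : ℂ → ℂ} (hf : DifferentiableOn ℂ f unitDisc) {r : ℝ}
    (hr0 : 0 ≤ r) (hr1 : r < 1) : Summable fun n => ‖macCoeff f n‖ * r ^ n := by
  have hz : (r : ℂ) ∈ unitDisc := by simpa [abs_of_nonneg hr0] using hr1
  have := (hasSum_macCoeff hf hz).summable.norm
  simpa [abs_of_nonneg hr0] using this

/-- Absorbing `r^n` into the coefficients reduces this to Parseval for a polynomial on the unit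
circle. -/
theorem circleAverage_norm_sq_partial (a : ℕ → ℂ) (N : ℕ) (r : ℝ) :
    Real.circleAverage (fun z => ‖∑ n ∈ Finset.range N, a n * z ^ n‖ ^ 2) 0 r =
      ∑ n ∈ Finset.range N, ‖a n‖ ^ 2 * (r ^ 2) ^ n := by
  let p : Polynomial ℂ := ∑ n ∈ Finset.range N, Polynomial.C (a n * (r : ℂ) ^ n) * Polynomial.X ^ n
  have hc : ∀ n, p.coeff n = if n < N then a n * (r : ℂ) ^ n else 0 := fun n => by
    simp only [p, Polynomial.finsetSum_coeff, Polynomial.coeff_C_mul_X_pow]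
    simp
  have h := p.sum_sq_norm_coeff_eq_circleAverage
  rw [Real.circleAverage_eq_circleAverage_zero_one]
  have e : ∀ z : ℂ, ∑ n ∈ Finset.range N, a n * (r * z + 0) ^ n = p.eval z := fun z => by
    simp only [p, Polynomial.eval_finsetSum, Polynomial.eval_mul, Polynomial.eval_C,
      Polynomial.eval_pow, Polynomial.eval_X]
    exact Finset.sum_congr rfl fun n _ => by ring
  simp only [e, ← h]
  have hs : p.support ⊆ Finset.range N := fun n hn => by
    rw [Polynomial.mem_support_iff, hc] at hn
    rw [Finset.mem_range]
    by_contra h'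
    simp [h'] at hn
  rw [Finset.sum_subset hs fun n _ hn => by simp [Polynomial.notMem_support_iff.1 hn]]
  refine Finset.sum_congr rfl fun n hn => ?_
  rw [hc, if_pos (Finset.mem_range.1 hn), norm_mul, mul_pow, norm_pow, Complex.norm_real,
    Real.norm_eq_abs, ← pow_mul, mul_comm n 2, pow_mul, sq_abs]

theorem circleIntegrable_norm_sq {f : ℂ → ℂ} (hf : ContinuousOn f unitDisc) {r : ℝ}
    (hr0 : 0 ≤ r) (hr1 : r < 1) : CircleIntegrable (fun z => ‖f z‖ ^ 2) 0 r := by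
  refine ContinuousOn.circleIntegrable hr0 ((hf.mono ?_).norm.pow 2)
  intro z hz
  simp only [mem_sphere_iff_norm, sub_zero] at hz
  simpa [hz] using hr1

/-- Parseval's identity. -/
theorem hasSum_circleAverage {f : ℂ → ℂ} (hf : DifferentiableOn ℂ f unitDisc) {r : ℝ}
    (hr0 : 0 ≤ r) (hr1 : r < 1) :
    HasSum (fun n => ‖macCoeff f n‖ ^ 2 * (r ^ 2) ^ n)
      (Real.circleAverage (fun z => ‖f z‖ ^ 2) 0 r) := by
  rw [hasSum_iff_tendsto_nat_of_nonneg (fun n => by positivity)]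
  simp only [← circleAverage_norm_sq_partial]
  unfold Real.circleAverage
  refine Tendsto.const_smul ?_ _
  have hmem : ∀ θ, circleMap 0 r θ ∈ unitDisc := fun θ => by
    simpa [abs_of_nonneg hr0] using hr1
  have hsum := summable_norm_macCoeff_mul_pow hf hr0 hr1
  -- On the circle of radius `r < 1` all partial sums are bounded by `∑ |f̂(n)| r^n`, so a constant
  -- dominates.
  refine intervalIntegral.tendsto_integral_filter_of_dominated_convergence
    (fun _ => (∑' n, ‖macCoeff f n‖ * r ^ n) ^ 2) ?_ ?_ ?_ ?_
  · refine Eventually.of_forall fun N => Continuous.aestronglyMeasurable ?_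
    have := continuous_circleMap 0 r
    fun_prop
  · refine Eventually.of_forall fun N => Eventually.of_forall fun θ _ => ?_
    rw [Real.norm_of_nonneg (by positivity)]
    refine pow_le_pow_left₀ (norm_nonneg _) ?_ 2
    refine (norm_sum_le _ _).trans ?_
    refine le_trans (le_of_eq ?_) (hsum.sum_le_tsum (Finset.range N) fun n _ => by positivity)
    refine Finset.sum_congr rfl fun n _ => ?_
    simp [abs_of_nonneg hr0]
  · simp
  · exact Eventually.of_forall fun θ _ =>
      ((hasSum_macCoeff hf (hmem θ)).tendsto_sum_nat.norm.pow 2)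

theorem hasSum_norm_sq (f : H2) : HasSum (fun n => ‖macCoeff f n‖ ^ 2) (‖f‖ ^ 2) := by
  have := lp.hasSum_norm (p := 2) (by norm_num) (coeffs f)
  simp only [ENNReal.toReal_ofNat, Real.rpow_ofNat, coeffs_apply] at this
  exact this

theorem hasSum_inner (f g : H2) :
    HasSum (fun n => conj (macCoeff f n) * macCoeff g n) ⟪f, g⟫_ℂ := by
  have := lp.hasSum_inner (𝕜 := ℂ) (coeffs f) (coeffs g)
  simp only [coeffs_apply, RCLike.inner_apply'] at this
  exact this

theorem circleAverage_le_norm_sq (f : H2) {r : ℝ} (hr0 : 0 ≤ r) (hr1 : r < 1) :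
    Real.circleAverage (fun z => ‖f z‖ ^ 2) 0 r ≤ ‖f‖ ^ 2 := by
  refine hasSum_le (fun n => ?_) (hasSum_circleAverage f.2.1 hr0 hr1) (hasSum_norm_sq f)
  exact mul_le_of_le_one_right (by positivity) (pow_le_one₀ (by positivity) (by nlinarith))

/-- Parseval bounds each finite sum weighted by `r^(2n)`; then `r → 1` from the left. Only finite
sums occur, so no summability is needed beforehand. -/
theorem sum_norm_sq_le_of_circleAverage_le {f : ℂ → ℂ} (hf : DifferentiableOn ℂ f unitDisc)
    {C : ℝ} (h : ∀ r : ℝ, 0 ≤ r → r < 1 → Real.circleAverage (fun z => ‖f z‖ ^ 2) 0 r ≤ C)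
    (s : Finset ℕ) : ∑ n ∈ s, ‖macCoeff f n‖ ^ 2 ≤ C := by
  have hcont : Continuous fun r : ℝ => ∑ n ∈ s, ‖macCoeff f n‖ ^ 2 * (r ^ 2) ^ n := by fun_prop
  have ht : Tendsto (fun r : ℝ => ∑ n ∈ s, ‖macCoeff f n‖ ^ 2 * (r ^ 2) ^ n) (𝓝[<] 1)
      (𝓝 (∑ n ∈ s, ‖macCoeff f n‖ ^ 2)) := by
    have := (hcont.tendsto 1).mono_left (nhdsWithin_le_nhds (s := Iio 1))
    simpa using this
  refine le_of_tendsto ht ?_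
  filter_upwards [Ioo_mem_nhdsLT (show (0 : ℝ) < 1 from one_pos)] with r hr
  exact (sum_le_hasSum s (fun n _ => by positivity)
    (hasSum_circleAverage hf hr.1.le hr.2)).trans (h r hr.1.le hr.2)

theorem exists_H2_of_circleAverage_le {f : ℂ → ℂ} (hf : DifferentiableOn ℂ f unitDisc) {C : ℝ}
    (h : ∀ r : ℝ, 0 ≤ r → r < 1 → Real.circleAverage (fun z => ‖f z‖ ^ 2) 0 r ≤ C) :
    ∃ F : H2, EqOn F f unitDisc ∧ ‖F‖ ^ 2 ≤ C := by
  have hb := sum_norm_sq_le_of_circleAverage_le hf h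
  have heq : EqOn (unitDisc.indicator f) f unitDisc := fun z hz => indicator_of_mem hz f
  have hs : Summable fun n => ‖macCoeff (unitDisc.indicator f) n‖ ^ 2 := by
    simp only [macCoeff_congr heq]
    exact summable_of_sum_le (fun n => by positivity) hb
  let F : H2 := ⟨unitDisc.indicator f, hf.congr heq, fun z hz => indicator_of_notMem hz f, hs⟩
  refine ⟨F, heq, ?_⟩
  refine (hasSum_le_of_sum_le (hasSum_norm_sq F) fun s => ?_)
  have e : ∀ n, macCoeff F n = macCoeff f n := macCoeff_congr heq
  simpa only [e] using hb s

theorem H2.ext_on {f g : H2} (h : EqOn f g unitDisc) : f = g := by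
  refine coeffs_injective ?_
  ext n
  exact macCoeff_congr h n

theorem H2.add_apply (f g : H2) (z : ℂ) : (f + g) z = f z + g z := rfl

theorem H2.smul_apply (c : ℂ) (f : H2) (z : ℂ) : (c • f) z = c * f z := rfl

theorem H2.sub_apply (f g : H2) (z : ℂ) : (f - g) z = f z - g z := rfl

/-- A linear transformation of functions that increases quadratic means over circles by a bounded
factor acts as a bounded operator. -/
theorem exists_clm_of_circleAverage_le (T : H2 → ℂ → ℂ) {C : ℝ} (hC : 0 ≤ C)
    (hadd : ∀ f g, ∀ z ∈ unitDisc, T (f + g) z = T f z + T g z)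
    (hsmul : ∀ (c : ℂ) f, ∀ z ∈ unitDisc, T (c • f) z = c * T f z)
    (hd : ∀ f, DifferentiableOn ℂ (T f) unitDisc)
    (h : ∀ f, ∀ r : ℝ, 0 ≤ r → r < 1 →
      Real.circleAverage (fun z => ‖T f z‖ ^ 2) 0 r ≤ C ^ 2 * ‖f‖ ^ 2) :
    ∃ A : H2 →L[ℂ] H2, (∀ f, ∀ z ∈ unitDisc, A f z = T f z) ∧ ∀ f, ‖A f‖ ≤ C * ‖f‖ := by
  choose F hF hFn using fun f => exists_H2_of_circleAverage_le (hd f) (h f)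
  have hn : ∀ f, ‖F f‖ ≤ C * ‖f‖ := fun f =>
    le_of_sq_le_sq (by simpa [mul_pow] using hFn f) (by positivity)
  let L : H2 →ₗ[ℂ] H2 :=
    { toFun := F
      map_add' := fun f g => H2.ext_on fun z hz => by
        rw [hF _ hz, H2.add_apply, hF _ hz, hF _ hz, hadd _ _ z hz]
      map_smul' := fun c f => H2.ext_on fun z hz => by
        rw [hF _ hz, RingHom.id_apply, H2.smul_apply, hF _ hz, hsmul _ _ z hz] }
  exact ⟨L.mkContinuous C hn, fun f z hz => hF f hz, hn⟩

theorem circleAverage_mul_le {f g : ℂ → ℂ} (hf : ContinuousOn f unitDisc)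
    (hg : ContinuousOn g unitDisc) {M : ℝ} (hM : ∀ z ∈ unitDisc, ‖g z‖ ≤ M) {r : ℝ} (hr0 : 0 ≤ r)
    (hr1 : r < 1) :
    Real.circleAverage (fun z => ‖g z * f z‖ ^ 2) 0 r ≤
      M ^ 2 * Real.circleAverage (fun z => ‖f z‖ ^ 2) 0 r := by
  rw [← smul_eq_mul (M ^ 2), ← Real.circleAverage_fun_smul]
  refine Real.circleAverage_mono (circleIntegrable_norm_sq (hg.mul hf) hr0 hr1) ?_ fun z hz => ?_
  · exact (circleIntegrable_norm_sq hf hr0 hr1).const_smul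
  · have hz' : z ∈ unitDisc := by
      rw [mem_sphere_iff_norm, sub_zero, abs_of_nonneg hr0] at hz
      simpa [hz] using hr1
    rw [norm_mul, mul_pow, smul_eq_mul]
    gcongr
    exact hM z hz'

/-- Multiplication by a bounded holomorphic function. -/
theorem exists_multiplicationOp {g : ℂ → ℂ} (hg : DifferentiableOn ℂ g unitDisc) {M : ℝ}
    (hM : ∀ z ∈ unitDisc, ‖g z‖ ≤ M) :
    ∃ A : H2 →L[ℂ] H2, IsMultiplicationOp g A ∧ ∀ f, ‖A f‖ ≤ M * ‖f‖ := by
  have hM0 : 0 ≤ M := (norm_nonneg _).trans (hM 0 zero_mem_unitDisc)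
  refine exists_clm_of_circleAverage_le (fun f z => g z * f z) hM0 (fun f h z _ => mul_add _ _ _)
    (fun c f z _ => mul_left_comm _ _ _) (fun f => hg.mul f.2.1) fun f r hr0 hr1 => ?_
  refine (circleAverage_mul_le f.2.1.continuousOn hg.continuousOn hM hr0 hr1).trans ?_
  gcongr
  exact circleAverage_le_norm_sq f hr0 hr1

/-! ### Monomials, kernels and the backward shift -/

/-- The function with prescribed Maclaurin coefficients. -/
def ofCoeffs (a : lp (fun _ : ℕ => ℂ) 2) : H2 := coeffEquiv.symm a

theorem macCoeff_ofCoeffs (a : lp (fun _ : ℕ => ℂ) 2) (n : ℕ) : macCoeff (ofCoeffs a) n = a n := by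
  rw [← coeffs_apply]
  exact congrArg (fun b : lp (fun _ : ℕ => ℂ) 2 => b n) (coeffEquiv.apply_symm_apply a)

/-- The monomial `z ^ n`. -/
def monom (n : ℕ) : H2 := ofCoeffs (lp.single 2 n 1)

theorem macCoeff_monom (n m : ℕ) : macCoeff (monom n) m = if m = n then 1 else 0 := by
  rw [monom, macCoeff_ofCoeffs, lp.single_apply]
  split_ifs with h <;> simp [h]

theorem monom_apply (n : ℕ) {z : ℂ} (hz : z ∈ unitDisc) : monom n z = z ^ n := by
  refine (hasSum_maclaurin (monom n) hz).unique ?_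
  simp only [macCoeff_monom]
  convert hasSum_ite_eq n (z ^ n) using 2 with m
  split_ifs with h <;> simp [h]

theorem inner_monom (n : ℕ) (f : H2) : ⟪monom n, f⟫_ℂ = macCoeff f n := by
  refine (hasSum_inner _ _).unique ?_
  simp only [macCoeff_monom]
  convert hasSum_ite_eq n (macCoeff f n) using 2 with m
  split_ifs with h <;> simp [h]

theorem norm_monom (n : ℕ) : ‖monom n‖ = 1 := by
  have h := norm_sq_eq_re_inner (𝕜 := ℂ) (monom n)
  rw [inner_monom, macCoeff_monom, if_pos rfl] at h
  have : ‖monom n‖ ^ 2 = 1 := by simpa using h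
  nlinarith [norm_nonneg (monom n)]

/-- The sup norm dominates the norm of the Hardy space. -/
theorem norm_le_of_forall_norm_le {f : H2} {C : ℝ} (h : ∀ z ∈ unitDisc, ‖f z‖ ≤ C) : ‖f‖ ≤ C := by
  -- `f` is the multiplier `f` applied to the constant function 1, which has norm 1.
  obtain ⟨A, hA, hn⟩ := exists_multiplicationOp f.2.1 h
  have : A (monom 0) = f := H2.ext_on fun z hz => by rw [hA _ z hz, monom_apply 0 hz]; simp
  simpa [this, norm_monom] using hn (monom 0)

/-- Every function in the Hardy space is the sum of its Maclaurin series. -/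
theorem hasSum_smul_monom (f : H2) : HasSum (fun n => macCoeff f n • monom n) f := by
  have h := lp.hasSum_single (p := 2) (by norm_num) (coeffs f)
  have h2 := h.mapL (coeffEquiv.symm.toContinuousLinearEquiv : _ →L[ℂ] H2)
  convert h2 using 1
  · funext n
    refine coeffs_injective ?_
    ext m
    rw [map_smul]
    change macCoeff f n • coeffs (monom n) m = coeffs (ofCoeffs _) m
    rw [coeffs_apply, coeffs_apply, macCoeff_ofCoeffs, macCoeff_monom, lp.single_apply,
      coeffs_apply]
    split_ifs with h
    · simp [h]
    · simp [h]
  · exact (coeffEquiv.symm_apply_apply f).symm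

theorem exists_kernel {z : ℂ} (hz : z ∈ unitDisc) :
    ∃ k : H2, (∀ f : H2, ⟪k, f⟫_ℂ = f z) ∧ ∀ w ∈ unitDisc, k w = 1 / (1 - conj z * w) := by
  have hz' : ‖z‖ < 1 := by simpa using hz
  have hs : Memℓp (fun n : ℕ => conj z ^ n) 2 := by
    rw [memlp_two_iff]
    simp only [norm_pow, RCLike.norm_conj, ← pow_mul, mul_comm _ 2]
    simp only [pow_mul]
    exact summable_geometric_of_lt_one (by positivity) (by nlinarith [norm_nonneg z])
  refine ⟨ofCoeffs ⟨_, hs⟩, fun f => ?_, fun w hw => ?_⟩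
  · refine (hasSum_inner _ _).unique ?_
    simp only [macCoeff_ofCoeffs]
    simpa [mul_comm] using hasSum_maclaurin f hz
  · have hw' : ‖w‖ < 1 := by simpa using hw
    refine (hasSum_maclaurin _ hw).unique ?_
    simp only [macCoeff_ofCoeffs, ← mul_pow]
    rw [one_div]
    refine hasSum_geometric_of_norm_lt_one ?_
    rw [norm_mul, RCLike.norm_conj]
    nlinarith [norm_nonneg z, norm_nonneg w]

/-- Point evaluation as a continuous functional. -/
theorem exists_evalCLM {z : ℂ} (hz : z ∈ unitDisc) : ∃ L : H2 →L[ℂ] ℂ, ∀ f : H2, L f = f z := by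
  obtain ⟨k, hk, -⟩ := exists_kernel hz
  exact ⟨innerSL ℂ k, fun f => hk f⟩

theorem exists_backwardShift : ∃ B : H2 →L[ℂ] H2, IsBackwardShift B ∧
    ∀ n, B (monom (n + 1)) = monom n := by
  have hs : ∀ f : H2, Memℓp (fun n => macCoeff f (n + 1)) 2 := fun f => by
    rw [memlp_two_iff]
    exact (summable_nat_add_iff 1).2 f.2.2.2
  let L : H2 →ₗ[ℂ] H2 :=
    { toFun := fun f => ofCoeffs ⟨_, hs f⟩
      map_add' := fun f g => by
        refine coeffs_injective ?_
        ext n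
        rw [map_add]
        simp only [lp.coeFn_add, Pi.add_apply, coeffs_apply, macCoeff_ofCoeffs]
        exact macCoeff_add f.2.1 g.2.1 _
      map_smul' := fun c f => by
        refine coeffs_injective ?_
        ext n
        rw [map_smul]
        simp only [lp.coeFn_smul, Pi.smul_apply, coeffs_apply, macCoeff_ofCoeffs]
        exact macCoeff_smul c f.2.1 _ }
  have hL : ∀ f n, macCoeff (L f) n = macCoeff f (n + 1) := fun f n => macCoeff_ofCoeffs _ n
  have hn : ∀ f, ‖L f‖ ≤ 1 * ‖f‖ := fun f => by
    rw [one_mul]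
    refine le_of_sq_le_sq ?_ (norm_nonneg f)
    have h1 := hasSum_norm_sq (L f)
    simp only [hL] at h1
    have h2 := (hasSum_nat_add_iff' 1).2 (hasSum_norm_sq f)
    rw [h1.unique h2]
    simp
  refine ⟨L.mkContinuous 1 hn, fun f z hz => ?_, fun n => ?_⟩
  · change L f z = _
    have h1 := hasSum_maclaurin (L f) hz
    simp only [hL] at h1
    split_ifs with h0
    · rw [h0, ← macCoeff_one]
      exact (macCoeff_zero _).symm.trans (hL f 0)
    · have h2 := (hasSum_nat_add_iff' 1).2 (hasSum_maclaurin f hz)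
      simp only [Finset.sum_range_one, pow_zero, mul_one, macCoeff_zero] at h2
      rw [eq_div_iff h0]
      have e : (fun n => macCoeff f (n + 1) * z ^ (n + 1)) =
          fun n => macCoeff f (n + 1) * z ^ n * z := by
        funext n
        ring
      rw [e] at h2
      exact (h1.mul_right z).unique h2
  · refine coeffs_injective ?_
    ext m
    refine (hL _ _).trans ?_
    simp [coeffs_apply, macCoeff_monom]

/-! ### Composition operators -/

/-- The sum is `c₀ v + S(...)`, with orthogonal summands; Pythagoras and the contractivity of `S`
give the induction step. In the application `S` is multiplication by `ψ` and `v` is the kernel at a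
zero of `ψ`. -/
theorem norm_sum_smul_pow_apply_sq_le {H : Type*} [NormedAddCommGroup H] [InnerProductSpace ℂ H]
    {S : H →L[ℂ] H} (hS : ∀ x, ‖S x‖ ≤ ‖x‖) {v : H} (hv : ∀ x, ⟪v, S x⟫_ℂ = 0) (N : ℕ)
    (c : ℕ → ℂ) :
    ‖∑ n ∈ Finset.range N, c n • (S ^ n) v‖ ^ 2 ≤ ‖v‖ ^ 2 * ∑ n ∈ Finset.range N, ‖c n‖ ^ 2 := by
  induction N generalizing c with
  | zero => simp
  | succ N ih =>
    have e : ∑ n ∈ Finset.range N, c (n + 1) • (S ^ (n + 1)) v =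
        S (∑ n ∈ Finset.range N, c (n + 1) • (S ^ n) v) := by
      simp [pow_succ']
    rw [Finset.sum_range_succ', Finset.sum_range_succ', e, pow_zero, one_apply_eq_self,
      add_comm, norm_add_sq (𝕜 := ℂ), inner_smul_left, hv, mul_zero, norm_smul]
    have h1 := pow_le_pow_left₀ (norm_nonneg _)
      (hS (∑ n ∈ Finset.range N, c (n + 1) • (S ^ n) v)) 2
    have h2 := ih fun n => c (n + 1)
    simp only [map_zero, mul_zero, add_zero]
    nlinarith

theorem norm_finset_sum_smul_pow_apply_sq_le {H : Type*} [NormedAddCommGroup H]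
    [InnerProductSpace ℂ H] {S : H →L[ℂ] H} (hS : ∀ x, ‖S x‖ ≤ ‖x‖) {v : H}
    (hv : ∀ x, ⟪v, S x⟫_ℂ = 0) (s : Finset ℕ) (c : ℕ → ℂ) :
    ‖∑ n ∈ s, c n • (S ^ n) v‖ ^ 2 ≤ ‖v‖ ^ 2 * ∑ n ∈ s, ‖c n‖ ^ 2 := by
  obtain ⟨N, hN⟩ := s.exists_nat_subset_range
  have h := norm_sum_smul_pow_apply_sq_le hS hv N fun n => if n ∈ s then c n else 0
  have h1 : ∑ n ∈ Finset.range N, (if n ∈ s then c n else 0) • (S ^ n) v =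
      ∑ n ∈ s, c n • (S ^ n) v := by
    simp only [ite_smul, zero_smul, Finset.sum_ite_mem, Finset.inter_eq_right.2 hN]
  have h2 : ∑ n ∈ Finset.range N, ‖if n ∈ s then c n else 0‖ ^ 2 = ∑ n ∈ s, ‖c n‖ ^ 2 := by
    rw [← Finset.inter_eq_right.2 hN, ← Finset.sum_ite_mem]
    refine Finset.sum_congr rfl fun n _ => ?_
    split_ifs <;> simp_all
  rwa [h1, h2] at h

/-- If the vector `v` is orthogonal to the range of the contraction `S`, then `z ^ n ↦ S ^ n v`
defines a bounded operator on the Hardy space. -/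
theorem exists_clm_pow_apply {S : H2 →L[ℂ] H2} (hS : ∀ x, ‖S x‖ ≤ ‖x‖) {v : H2}
    (hv : ∀ x, ⟪v, S x⟫_ℂ = 0) :
    ∃ W : H2 →L[ℂ] H2, ∀ f : H2, HasSum (fun n => macCoeff f n • (S ^ n) v) (W f) := by
  have key := norm_finset_sum_smul_pow_apply_sq_le hS hv
  have hsum : ∀ f : H2, Summable fun n => macCoeff f n • (S ^ n) v := fun f => by
    rw [summable_iff_vanishing_norm]
    intro ε hε
    obtain ⟨s, hs⟩ := summable_iff_vanishing_norm.1 (f.2.2.2.mul_left (‖v‖ ^ 2)) (ε ^ 2)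
      (by positivity)
    refine ⟨s, fun t ht => lt_of_pow_lt_pow_left₀ 2 hε.le ?_⟩
    refine (key t _).trans_lt (lt_of_le_of_lt ?_ (hs t ht))
    rw [← Finset.mul_sum]
    exact le_abs_self _
  let L : H2 →ₗ[ℂ] H2 :=
    { toFun := fun f => ∑' n, macCoeff f n • (S ^ n) v
      map_add' := fun f g => by
        rw [← (hsum f).tsum_add (hsum g)]
        refine tsum_congr fun n => ?_
        rw [← add_smul]
        congr 1
        exact macCoeff_add f.2.1 g.2.1 n
      map_smul' := fun c f => by
        rw [RingHom.id_apply, ← (hsum f).tsum_const_smul c]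
        refine tsum_congr fun n => ?_
        rw [smul_smul]
        congr 1
        exact macCoeff_smul c f.2.1 n }
  have hn : ∀ f, ‖L f‖ ≤ ‖v‖ * ‖f‖ := fun f => by
    refine le_of_tendsto (hsum f).hasSum.norm (Eventually.of_forall fun s => ?_)
    refine le_of_sq_le_sq ((key s _).trans ?_) (by positivity)
    rw [mul_pow]
    gcongr
    exact sum_le_hasSum s (fun n _ => by positivity) (hasSum_norm_sq f)
  exact ⟨L.mkContinuous _ hn, fun f => (hsum f).hasSum⟩

theorem norm_lt_one_of_mem {z : ℂ} (hz : z ∈ unitDisc) : ‖z‖ < 1 := by simpa using hz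

theorem one_sub_conj_mul_ne_zero {a z : ℂ} (ha : a ∈ unitDisc) (hz : z ∈ unitDisc) :
    1 - conj a * z ≠ 0 := by
  have ha' := norm_lt_one_of_mem ha
  have hz' := norm_lt_one_of_mem hz
  intro h
  have h1 : ‖conj a * z‖ = 1 := by rw [← sub_eq_zero.1 h, norm_one]
  rw [norm_mul, RCLike.norm_conj] at h1
  nlinarith [norm_nonneg a, norm_nonneg z]

/-- Every `ψf` vanishes at `b`, so the kernel `k` at `b` is orthogonal to the range of `M_ψ`. Hence
`f ↦ k · (f ∘ ψ)` is bounded, and multiplication by `1/k = 1 - conj b * z` removes the factor `k`.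
-/
theorem exists_compositionOp_of_zero {ψ : ℂ → ℂ} (hd : DifferentiableOn ℂ ψ unitDisc)
    (hm : MapsTo ψ unitDisc unitDisc) {b : ℂ} (hb : b ∈ unitDisc) (h0 : ψ b = 0) :
    ∃ A : H2 →L[ℂ] H2, IsCompositionOp ψ A := by
  obtain ⟨S, hS, hSn⟩ := exists_multiplicationOp hd (M := 1)
    fun z hz => (norm_lt_one_of_mem (hm hz)).le
  obtain ⟨k, hk, hkv⟩ := exists_kernel hb
  obtain ⟨W, hW⟩ := exists_clm_pow_apply (S := S) (by simpa using hSn) (v := k) fun f => by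
    rw [hk, hS f b hb, h0, zero_mul]
  have hb2 : ∀ z ∈ unitDisc, ‖1 - conj b * z‖ ≤ 2 := fun z hz => by
    have := norm_lt_one_of_mem hb
    have := norm_lt_one_of_mem hz
    refine (norm_sub_le _ _).trans ?_
    rw [norm_one, norm_mul, RCLike.norm_conj]
    nlinarith [norm_nonneg b, norm_nonneg z]
  obtain ⟨M, hM, -⟩ := exists_multiplicationOp (g := fun z => 1 - conj b * z) (by fun_prop) hb2
  refine ⟨M ∘L W, fun f z hz => ?_⟩
  rw [ContinuousLinearMap.comp_apply, hM _ z hz]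
  obtain ⟨E, hE⟩ := exists_evalCLM hz
  have hpow : ∀ n, ((S ^ n) k) z = ψ z ^ n * k z := fun n => by
    induction n with
    | zero => simp
    | succ n ih =>
      rw [pow_succ', mul_apply_eq_comp, hS _ z hz, ih]
      ring
  have h1 := (hW f).mapL E
  have e : (fun n => E (macCoeff f n • (S ^ n) k)) =
      fun n => macCoeff f n * (ψ z ^ n * k z) := by
    funext n
    rw [map_smul, hE, hpow, smul_eq_mul]
  rw [e, hE] at h1
  have h2 := (hasSum_maclaurin f (hm hz)).mul_right (k z)
  simp only [mul_assoc] at h2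
  rw [h1.unique h2, hkv z hz]
  have := one_sub_conj_mul_ne_zero hb hz
  field_simp

theorem norm_sub_lt_norm_one_sub_conj_mul {a w : ℂ} (ha : a ∈ unitDisc) (hw : w ∈ unitDisc) :
    ‖a - w‖ < ‖1 - conj a * w‖ := by
  have ha' := norm_lt_one_of_mem ha
  have hw' := norm_lt_one_of_mem hw
  refine lt_of_pow_lt_pow_left₀ 2 (norm_nonneg _) ?_
  have e : ‖1 - conj a * w‖ ^ 2 - ‖a - w‖ ^ 2 = (1 - ‖a‖ ^ 2) * (1 - ‖w‖ ^ 2) := by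
    simp only [← Complex.normSq_eq_norm_sq, Complex.normSq_apply, Complex.sub_re, Complex.sub_im,
      Complex.mul_re, Complex.mul_im, Complex.conj_re, Complex.conj_im, Complex.one_re,
      Complex.one_im]
    ring
  have : 0 < (1 - ‖a‖ ^ 2) * (1 - ‖w‖ ^ 2) :=
    mul_pos (by nlinarith [norm_nonneg a]) (by nlinarith [norm_nonneg w])
  linarith

/-- Littlewood's subordination theorem: every holomorphic selfmap of the disc induces a bounded
composition operator on the Hardy space. -/
theorem exists_compositionOp {ψ : ℂ → ℂ} (hd : DifferentiableOn ℂ ψ unitDisc)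
    (hm : MapsTo ψ unitDisc unitDisc) : ∃ A : H2 →L[ℂ] H2, IsCompositionOp ψ A := by
  set a := ψ 0 with ha_def
  have ha : a ∈ unitDisc := hm zero_mem_unitDisc
  -- The disc involution exchanging `0` and `a = ψ(0)`. Both `α` and `α ∘ ψ` have a zero in the
  -- disc, and `f ∘ ψ = (f ∘ α) ∘ (α ∘ ψ)`.
  let α : ℂ → ℂ := fun w => (a - w) / (1 - conj a * w)
  have hαd : DifferentiableOn ℂ α unitDisc := by
    refine DifferentiableOn.div (by fun_prop) (by fun_prop) fun w hw => ?_
    exact one_sub_conj_mul_ne_zero ha hw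
  have hαm : MapsTo α unitDisc unitDisc := fun w hw => by
    have := norm_sub_lt_norm_one_sub_conj_mul ha hw
    simpa [α, div_lt_one ((norm_nonneg _).trans_lt this)] using this
  have hαα : ∀ w ∈ unitDisc, α (α w) = w := fun w hw => by
    have h1 := one_sub_conj_mul_ne_zero ha hw
    have h2 := one_sub_conj_mul_ne_zero ha (hαm hw)
    have h3 : α w * (1 - conj a * w) = a - w := div_mul_cancel₀ _ h1
    change (a - α w) / (1 - conj a * α w) = w
    rw [div_eq_iff h2]
    linear_combination -h3
  obtain ⟨A₁, hA₁⟩ := exists_compositionOp_of_zero hαd hαm ha (by simp [α])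
  obtain ⟨A₂, hA₂⟩ := exists_compositionOp_of_zero (hαd.comp hd hm) (hαm.comp hm)
    zero_mem_unitDisc (by simp [α, ← ha_def])
  refine ⟨A₂ ∘L A₁, fun f z hz => ?_⟩
  rw [ContinuousLinearMap.comp_apply, hA₂ _ z hz]
  refine (hA₁ f _ (hαm (hm hz))).trans ?_
  rw [hαα _ (hm hz)]

/-! ### Compact operators -/

theorem isCompactOperator_smulRight (l : H2 →L[ℂ] ℂ) (v : H2) :
    IsCompactOperator (l.smulRight v) := by
  have h : IsCompactOperator l := isCompactOperator_of_locallyCompactSpace_dom l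
  exact h.clm_comp (ContinuousLinearMap.toSpanSingleton ℂ v)

/-- An operator with summable norms on the monomials is compact. -/
theorem isCompactOperator_of_summable {T : H2 →L[ℂ] H2} (h : Summable fun n => ‖T (monom n)‖) :
    IsCompactOperator T := by
  -- The rank-one pieces `f ↦ f̂(n) T(z^n)`; their sum converges to `T` in operator norm.
  let R : ℕ → H2 →L[ℂ] H2 := fun n => (innerSL ℂ (monom n)).smulRight (T (monom n))
  have hR : Summable R := by
    refine Summable.of_norm_bounded h fun n => ?_
    simp [R, ContinuousLinearMap.norm_smulRight_apply, norm_monom]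
  have hT : HasSum R T := by
    convert hR.hasSum using 1
    ext1 f
    have h1 := (hasSum_smul_monom f).mapL T
    have h2 := hR.hasSum.mapL (ContinuousLinearMap.apply ℂ H2 f)
    refine h1.unique ?_
    convert h2 using 1
    · funext n
      simp [R, inner_monom]
    · rfl
  refine isCompactOperator_of_tendsto hT (Eventually.of_forall fun s => ?_)
  classical
  induction s using Finset.induction_on with
  | empty => simpa using isCompactOperator_zero
  | insert a s ha ih =>
    rw [Finset.sum_insert ha]
    exact (isCompactOperator_smulRight _ _).add ih

/-! ### Branches of inverses over the closed disc -/

/-- Local injectivity and openness both survive restriction to a full preimage, so `s` may be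
arbitrary; it will be the closed disc. -/
theorem _root_.IsLocalHomeomorph.restrictPreimage {X Y : Type*} [TopologicalSpace X]
    [TopologicalSpace Y] {f : X → Y} (hf : IsLocalHomeomorph f) (s : Set Y) :
    IsLocalHomeomorph (s.restrictPreimage f) := by
  rw [isLocalHomeomorph_iff_isOpenEmbedding_restrict]
  intro x
  obtain ⟨U, hU, hxU, hinj⟩ := hf.isLocallyInjective x.1
  have hU' : IsOpen ((↑) ⁻¹' U : Set (f ⁻¹' s)) := hU.preimage continuous_subtype_val
  refine ⟨(↑) ⁻¹' U, hU'.mem_nhds hxU, ?_⟩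
  refine .of_continuous_injective_isOpenMap ?_ ?_ ?_
  · exact (hf.continuous.restrictPreimage).comp continuous_subtype_val
  · rintro ⟨a, ha⟩ ⟨b, hb⟩ hab
    have : f a = f b := congrArg Subtype.val hab
    exact Subtype.ext (Subtype.ext (hinj ha hb this))
  · exact (hf.isOpenMap.restrictPreimage s).comp hU'.isOpenMap_subtype_val

theorem exists_injOn_nhds_of_hasStrictDerivAt {F : ℂ → ℂ} {F' u : ℂ} (h : HasStrictDerivAt F F' u)
    (h' : F' ≠ 0) : ∃ e : OpenPartialHomeomorph ℂ ℂ, u ∈ e.source ∧ (e : ℂ → ℂ) = F := by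
  have hs := h.hasStrictFDerivAt_equiv h'
  exact ⟨hs.toOpenPartialHomeomorph F, hs.mem_toOpenPartialHomeomorph_source, by simp⟩

/-- A map that is locally invertible over the closed disc, the preimage of the closed disc being
compact, has an inverse branch over the closed disc through every point of that preimage. -/
theorem exists_continuousOn_branch {F F' : ℂ → ℂ} {E : Set ℂ} (hE : IsOpen E)
    (hF : ∀ u ∈ E, HasStrictDerivAt F (F' u) u) (hF' : ∀ u ∈ E, F' u ≠ 0)
    (hK : IsCompact (E ∩ F ⁻¹' closedBall 0 1)) {u₀ : ℂ} (hu₀ : u₀ ∈ E)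
    (hz₀ : F u₀ ∈ closedBall (0 : ℂ) 1) :
    ∃ σ : ℂ → ℂ, ContinuousOn σ (closedBall 0 1) ∧ σ (F u₀) = u₀ ∧
      ∀ z ∈ closedBall (0 : ℂ) 1, σ z ∈ E ∧ F (σ z) = z := by
  classical
  let D : Set ℂ := closedBall 0 1
  let f : E → ℂ := fun u => F u
  have hf : IsLocalHomeomorph f := by
    have h1 : IsLocalHomeomorphOn F E := fun u hu => by
      obtain ⟨e, he, heF⟩ := exists_injOn_nhds_of_hasStrictDerivAt (hF u hu) (hF' u hu)
      exact ⟨e, he, heF.symm⟩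
    rw [isLocalHomeomorph_iff_isLocalHomeomorphOn_univ]
    exact h1.comp hE.isOpenEmbedding_subtypeVal.isLocalHomeomorph.isLocalHomeomorphOn
      fun u _ => u.2
  have : CompactSpace (f ⁻¹' D) := by
    rw [← isCompact_iff_compactSpace, Subtype.isCompact_iff]
    convert hK using 1
    ext u
    simp [f, D, and_comm]
  -- A local homeomorphism from a compact space is a covering here, and the identity lifts through
  -- it because the disc is contractible and locally path connected.
  have hcov : IsCoveringMap (D.restrictPreimage f) :=
    isLocalHomeomorph_iff_isCoveringMap.1 (hf.restrictPreimage D)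
  have hconv : Convex ℝ D := convex_closedBall 0 1
  have := hconv.contractibleSpace ⟨_, hz₀⟩
  have := hconv.locallyPathConnectedSpace
  obtain ⟨G, ⟨hG₀, hG⟩, -⟩ := hcov.existsUnique_continuousMap_lifts (ContinuousMap.id D)
    ⟨F u₀, hz₀⟩ ⟨⟨u₀, hu₀⟩, hz₀⟩ rfl
  refine ⟨fun z => if h : z ∈ D then G ⟨z, h⟩ else 0, ?_, ?_, fun z hz => ?_⟩
  · rw [continuousOn_iff_continuous_domRestrict]
    have : Continuous fun z : D => ((G z : E) : ℂ) :=
      continuous_subtype_val.comp (continuous_subtype_val.comp G.continuous)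
    convert this using 1
    funext z
    simp [Set.domRestrict]
  · simp [D, mem_closedBall_zero_iff.1 hz₀, hG₀]
  · have h1 := congrFun hG ⟨z, hz⟩
    have h2 : F (G ⟨z, hz⟩) = z := congrArg Subtype.val h1
    have hz' : z ∈ D := hz
    simp only [hz', dif_pos]
    exact ⟨(G ⟨z, hz⟩).1.2, h2⟩

/-- The points over the closed disc that are off a continuous branch form a compact set. -/
theorem isCompact_off_branch {F F' σ : ℂ → ℂ} {E : Set ℂ}
    (hF : ∀ u ∈ E, HasStrictDerivAt F (F' u) u) (hF' : ∀ u ∈ E, F' u ≠ 0)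
    (hK : IsCompact (E ∩ F ⁻¹' closedBall 0 1)) (hσ : ContinuousOn σ (closedBall 0 1))
    (hFσ : ∀ z ∈ closedBall (0 : ℂ) 1, σ z ∈ E ∧ F (σ z) = z) :
    IsCompact {u | u ∈ E ∩ F ⁻¹' closedBall 0 1 ∧ σ (F u) ≠ u} := by
  refine hK.of_isClosed_subset (isClosed_of_closure_subset fun u hu => ?_) fun u hu => hu.1
  have huK : u ∈ E ∩ F ⁻¹' closedBall 0 1 :=
    hK.isClosed.closure_subset_iff.2 (fun v hv => hv.1) hu
  refine ⟨huK, fun heq => ?_⟩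
  obtain ⟨e, he, heF⟩ := exists_injOn_nhds_of_hasStrictDerivAt (hF u huK.1) (hF' u huK.1)
  have hN : e.source ∈ 𝓝 u := e.open_source.mem_nhds he
  have h1 : Tendsto F (𝓝[E ∩ F ⁻¹' closedBall 0 1] u) (𝓝[closedBall 0 1] F u) :=
    tendsto_nhdsWithin_iff.2 ⟨(hF u huK.1).hasDerivAt.continuousAt.tendsto.mono_left
      nhdsWithin_le_nhds, eventually_mem_nhdsWithin.mono fun v hv => hv.2⟩
  have h2 : Tendsto (fun v => σ (F v)) (𝓝[E ∩ F ⁻¹' closedBall 0 1] u) (𝓝 u) := by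
    have := (hσ (F u) huK.2).tendsto.comp h1
    rwa [heq] at this
  -- If the limit `u` were on the branch, then for `v` near `u` both `σ(F v)` and `v` would lie
  -- where `F` is injective, with the same image; so nearby points would be on the branch too.
  have h3 : ∀ᶠ v in 𝓝[E ∩ F ⁻¹' closedBall 0 1] u, σ (F v) = v := by
    filter_upwards [h2 hN, nhdsWithin_le_nhds hN, eventually_mem_nhdsWithin] with v hv1 hv2 hv3
    refine e.injOn hv1 hv2 ?_
    rw [heF]
    exact (hFσ _ hv3.2).2
  rw [eventually_nhdsWithin_iff] at h3
  obtain ⟨v, hv, hv'⟩ := ((mem_closure_iff_frequently.1 hu).and_eventually h3).exists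
  exact hv.2 (hv' hv.1)

theorem hasDerivAt_branch {F F' σ : ℂ → ℂ} {E : Set ℂ}
    (hF : ∀ u ∈ E, HasStrictDerivAt F (F' u) u) (hF' : ∀ u ∈ E, F' u ≠ 0)
    (hσ : ContinuousOn σ (closedBall 0 1))
    (hFσ : ∀ z ∈ closedBall (0 : ℂ) 1, σ z ∈ E ∧ F (σ z) = z) {z : ℂ} (hz : z ∈ unitDisc) :
    HasDerivAt σ (F' (σ z))⁻¹ z := by
  have hz' := ball_subset_closedBall hz
  have hnhds : closedBall (0 : ℂ) 1 ∈ 𝓝 z :=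
    mem_of_superset (isOpen_ball.mem_nhds hz) ball_subset_closedBall
  refine HasDerivAt.of_local_left_inverse (hσ.continuousAt hnhds)
    (hF _ (hFσ z hz').1).hasDerivAt (hF' _ (hFσ z hz').1) ?_
  filter_upwards [hnhds] with y hy using (hFσ y hy).2

open Polynomial

/-! ### Reversed conjugate polynomials and partial fractions -/

/-- The polynomial `z ^ d * conj (p (1 / conj z))`. -/
def revConj (d : ℕ) (p : ℂ[X]) : ℂ[X] := (p.map (starRingEnd ℂ)).reflect d

theorem eval_revConj {d : ℕ} {p : ℂ[X]} (hp : p.natDegree ≤ d) {u : ℂ} (hu : u ≠ 0) :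
    (revConj d p).eval u = u ^ d * conj (p.eval (1 / conj u)) := by
  let i : Invertible u⁻¹ := invertibleOfNonzero (inv_ne_zero hu)
  have h := eval₂_reflect_mul_pow (RingHom.id ℂ) u⁻¹ d (p.map (starRingEnd ℂ))
    (natDegree_map_le.trans hp)
  rw [invOf_eq_inv, inv_inv] at h
  have h2 : conj (p.eval (1 / conj u)) = (p.map (starRingEnd ℂ)).eval u⁻¹ := by
    have h3 := eval₂_hom (starRingEnd ℂ) (1 / conj u) (p := p)
    rw [map_div₀, map_one, Complex.conj_conj, one_div] at h3
    rw [eval_map, h3]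
  have h3 : (revConj d p).eval u * u⁻¹ ^ d = (p.map (starRingEnd ℂ)).eval u⁻¹ := h
  rw [h2, ← h3, inv_pow]
  field_simp

theorem eval_zero_revConj (d : ℕ) (p : ℂ[X]) : (revConj d p).eval 0 = conj (p.coeff d) := by
  rw [← coeff_zero_eq_eval_zero, revConj, coeff_reflect, revAt_le (Nat.zero_le d), coeff_map]
  simp

theorem coeff_revConj (d : ℕ) (p : ℂ[X]) : (revConj d p).coeff d = conj (p.coeff 0) := by
  rw [revConj, coeff_reflect, revAt_le le_rfl, coeff_map]
  simp

theorem natDegree_revConj_le {d : ℕ} {p : ℂ[X]} (hp : p.natDegree ≤ d) :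
    (revConj d p).natDegree ≤ d := by
  rw [natDegree_le_iff_coeff_eq_zero]
  intro n hn
  rw [revConj, coeff_reflect, revAt_eq_self_of_lt hn, coeff_map,
    coeff_eq_zero_of_natDegree_lt (hp.trans_lt hn), map_zero]

/-- The difference of the two sides has degree below `d` and vanishes at `d` points. -/
theorem eq_C_mul_nodal {D : ℂ[X]} {d : ℕ} (hD : D.natDegree ≤ d) {S : Finset ℂ} (hS : S.card = d)
    (hroot : ∀ u ∈ S, D.eval u = 0) : D = C (D.coeff d) * Lagrange.nodal S id := by
  have hn : (C (D.coeff d) * Lagrange.nodal S id).natDegree ≤ d :=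
    (natDegree_C_mul_le _ _).trans (by rw [Lagrange.natDegree_nodal, hS])
  refine eq_of_degree_sub_lt_of_eval_finset_eq S ?_ fun u hu => ?_
  · rw [hS, degree_lt_iff_coeff_zero]
    intro m hm
    rcases hm.eq_or_lt with rfl | hm
    · have h1 : (Lagrange.nodal S (id : ℂ → ℂ)).coeff d = 1 := by
        have := (Lagrange.nodal_monic (s := S) (v := (id : ℂ → ℂ))).coeff_natDegree
        rwa [Lagrange.natDegree_nodal, hS] at this
      simp [h1]
    · rw [coeff_sub, coeff_eq_zero_of_natDegree_lt (hD.trans_lt hm),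
        coeff_eq_zero_of_natDegree_lt (hn.trans_lt hm), sub_zero]
  · rw [hroot u hu, eval_mul, show u = id u from rfl, Lagrange.eval_nodal_at_node hu, mul_zero]

theorem derivative_eval_ne_zero_of_card_eq {D : ℂ[X]} {d : ℕ} (hD0 : D ≠ 0) (hD : D.natDegree ≤ d)
    {S : Finset ℂ} (hS : S.card = d) (hroot : ∀ u ∈ S, D.eval u = 0) {u : ℂ} (hu : u ∈ S) :
    D.derivative.eval u ≠ 0 := by
  classical
  have h := eq_C_mul_nodal hD hS hroot
  have hc : D.coeff d ≠ 0 := fun h0 => hD0 (by rw [h, h0]; simp)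
  have h1 := Lagrange.nodalWeight_ne_zero (v := (id : ℂ → ℂ)) (injOn_id _) hu
  rw [Lagrange.nodalWeight_eq_eval_derivative_nodal hu] at h1
  rw [h, derivative_C_mul, eval_mul, eval_C]
  exact mul_ne_zero hc fun h0 => h1 (by rw [id, h0, inv_zero])

/-- Partial fraction expansion of a rational function with simple poles. -/
theorem eval_div_eval_eq_add_sum {Q D : ℂ[X]} {d : ℕ} (hQ : Q.natDegree ≤ d) (hD0 : D ≠ 0)
    (hD : D.natDegree ≤ d) {S : Finset ℂ} (hS : S.card = d) (hroot : ∀ u ∈ S, D.eval u = 0) {x : ℂ}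
    (hx : D.eval x ≠ 0) :
    Q.eval x / D.eval x =
      Q.coeff d / D.coeff d + ∑ u ∈ S, Q.eval u / D.derivative.eval u * (x - u)⁻¹ := by
  classical
  have h := eq_C_mul_nodal hD hS hroot
  have hc : D.coeff d ≠ 0 := fun h0 => hD0 (by rw [h, h0]; simp)
  set a := Q.coeff d / D.coeff d with ha
  -- Subtracting the value at infinity, `a`, lowers the degree below `d`, so Lagrange interpolation
  -- at the roots of `D` recovers the remainder.
  have hdeg : (Q - C a * D).degree < S.card := by
    rw [hS, degree_lt_iff_coeff_zero]
    intro m hm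
    rcases hm.eq_or_lt with rfl | hm
    · rw [coeff_sub, coeff_C_mul, ha, div_mul_cancel₀ _ hc, sub_self]
    · rw [coeff_sub, coeff_C_mul, coeff_eq_zero_of_natDegree_lt (hQ.trans_lt hm),
        coeff_eq_zero_of_natDegree_lt (hD.trans_lt hm), mul_zero, sub_zero]
  have hint := Lagrange.eq_interpolate (v := (id : ℂ → ℂ)) (injOn_id _) hdeg
  have hxS : ∀ u ∈ S, x ≠ id u := fun u hu hxu => hx (by rw [hxu]; exact hroot u hu)
  have h2 := Lagrange.eval_interpolate_not_at_node
    (fun i => eval (id i) (Q - C a * D)) (s := S) (v := (id : ℂ → ℂ)) hxS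
  rw [← hint] at h2
  have h3 : Q.eval x = a * D.eval x + (Q - C a * D).eval x := by simp
  rw [h3, h2, add_div, mul_div_cancel_right₀ _ hx]
  congr 1
  have h4 : D.eval x = D.coeff d * (Lagrange.nodal S id).eval x := by
    conv_lhs => rw [h]
    rw [eval_mul, eval_C]
  have hnx : (Lagrange.nodal S id).eval x ≠ 0 := fun h0 => hx (by rw [h4, h0, mul_zero])
  rw [h4, mul_comm (D.coeff d), mul_div_mul_left _ _ hnx, Finset.sum_div]
  refine Finset.sum_congr rfl fun u hu => ?_
  have h5 : D.derivative.eval u = D.coeff d * (Lagrange.nodal S id).derivative.eval u := by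
    conv_lhs => rw [h]
    rw [derivative_C_mul, eval_mul, eval_C]
  rw [Lagrange.nodalWeight_eq_eval_derivative_nodal hu, h5]
  simp only [id, eval_sub, eval_mul, eval_C, hroot u hu, mul_zero, sub_zero]
  rw [div_eq_mul_inv, div_eq_mul_inv, mul_inv]
  ring

/-- The Taylor coefficients of a sum of simple fractions. -/
theorem hasSum_simple_fractions {S : Finset ℂ} (hS : ∀ u ∈ S, ‖u‖ < 1) (a : ℂ) (c : ℂ → ℂ) {v : ℂ}
    (hv : ‖v‖ < 1) :
    HasSum (fun n : ℕ => (if n = 0 then a else ∑ u ∈ S, c u * u ^ (n - 1)) * v ^ n)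
      (a + ∑ u ∈ S, c u * (v * (1 - u * v)⁻¹)) := by
  -- Each `v/(1 - uv)` has no constant term, so the constant `a` splits off and geometric series in
  -- `uv` remain.
  rw [← hasSum_nat_add_iff' 1]
  simp only [Finset.sum_range_one, if_true, pow_zero, mul_one, add_sub_cancel_left,
    Nat.add_eq_zero_iff, one_ne_zero, and_false, if_false, Nat.add_sub_cancel, Finset.sum_mul]
  refine hasSum_sum fun u hu => ?_
  have h : ‖u * v‖ < 1 := by
    rw [norm_mul]
    nlinarith [hS u hu, norm_nonneg u, norm_nonneg v]
  have := ((hasSum_geometric_of_norm_lt_one h).mul_left v).mul_left (c u)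
  have e : (fun n : ℕ => c u * u ^ n * v ^ (n + 1)) = fun n => c u * (v * (u * v) ^ n) := by
    funext n
    ring
  rwa [e]

/-! ### The exterior map in terms of polynomials -/

theorem circleInv_zero : circleInv ((0 : ℂ) : OnePoint ℂ) = OnePoint.infty := by
  simp [circleInv]

theorem circleInv_infty : circleInv OnePoint.infty = ((0 : ℂ) : OnePoint ℂ) := rfl

theorem circleInv_coe {z : ℂ} (hz : z ≠ 0) :
    circleInv (z : OnePoint ℂ) = ((1 / conj z : ℂ) : OnePoint ℂ) := by
  simp [circleInv, hz]

theorem circleInv_circleInv (x : OnePoint ℂ) : circleInv (circleInv x) = x := by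
  induction x using OnePoint.rec with
  | infty => rw [circleInv_infty, circleInv_zero]
  | coe z =>
    by_cases hz : z = 0
    · rw [hz, circleInv_zero, circleInv_infty]
    · rw [circleInv_coe hz, circleInv_coe (by simpa using hz)]
      simp

theorem exteriorMap_eq_iff_sphereMap_eq (φ : RatFunc ℂ) (x y : OnePoint ℂ) :
    exteriorMap φ x = y ↔ sphereMap φ (circleInv x) = circleInv y := by
  rw [exteriorMap, Function.comp_apply, Function.comp_apply]
  exact ⟨fun h => by rw [← h, circleInv_circleInv], fun h => by rw [h, circleInv_circleInv]⟩

theorem sphereMap_coe (φ : RatFunc ℂ) {z : ℂ} (hz : φ.denom.eval z ≠ 0) :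
    sphereMap φ z = ((φ.num.eval z / φ.denom.eval z : ℂ) : OnePoint ℂ) := by
  change (if φ.denom.eval z = 0 then _ else _) = _
  rw [if_neg hz]
  rfl

theorem sphereMap_coe_of_eq_zero (φ : RatFunc ℂ) {z : ℂ} (hz : φ.denom.eval z = 0) :
    sphereMap φ z = OnePoint.infty := by
  change (if φ.denom.eval z = 0 then _ else _) = _
  rw [if_pos hz]

theorem not_eval_num_eq_zero_and (φ : RatFunc ℂ) (z : ℂ) (h1 : φ.num.eval z = 0)
    (h2 : φ.denom.eval z = 0) : False := by
  obtain ⟨a, b, hab⟩ := φ.isCoprime_num_denom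
  have := congrArg (eval z) hab
  simp [h1, h2] at this

/-- The numerator of the exterior map. -/
def extNum (φ : RatFunc ℂ) : ℂ[X] := revConj (ratDegree φ) φ.denom

/-- The denominator of the exterior map. -/
def extDenom (φ : RatFunc ℂ) : ℂ[X] := revConj (ratDegree φ) φ.num

theorem eval_extNum (φ : RatFunc ℂ) {u : ℂ} (hu : u ≠ 0) :
    (extNum φ).eval u = u ^ ratDegree φ * conj (φ.denom.eval (1 / conj u)) :=
  eval_revConj (le_max_right _ _) hu

theorem eval_extDenom (φ : RatFunc ℂ) {u : ℂ} (hu : u ≠ 0) :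
    (extDenom φ).eval u = u ^ ratDegree φ * conj (φ.num.eval (1 / conj u)) :=
  eval_revConj (le_max_left _ _) hu

/-- Away from `0` this is coprimality of `p` and `q`. At `0` the values are the conjugated
coefficients of index `d`, one of which is a leading coefficient. -/
theorem not_eval_extNum_eq_zero_and (φ : RatFunc ℂ) (u : ℂ) (h1 : (extNum φ).eval u = 0)
    (h2 : (extDenom φ).eval u = 0) : False := by
  by_cases hu : u = 0
  · rw [hu, extNum, eval_zero_revConj, map_eq_zero] at h1
    rw [hu, extDenom, eval_zero_revConj, map_eq_zero] at h2
    rcases max_choice φ.num.natDegree φ.denom.natDegree with h | h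
    · rw [ratDegree, h, coeff_natDegree, leadingCoeff_eq_zero] at h2
      rw [ratDegree, h, h2, natDegree_zero] at h1
      rw [h2, natDegree_zero] at h
      have := φ.monic_denom.coeff_natDegree
      rw [show φ.denom.natDegree = 0 by omega, h1] at this
      exact zero_ne_one this
    · rw [ratDegree, h, φ.monic_denom.coeff_natDegree] at h1
      exact one_ne_zero h1
  · rw [eval_extNum φ hu] at h1
    rw [eval_extDenom φ hu] at h2
    simp only [mul_eq_zero, pow_eq_zero_iff', hu, false_and, false_or, map_eq_zero] at h1 h2
    exact not_eval_num_eq_zero_and φ _ h2 h1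

theorem valueAtInfty_eq_circleInv_iff (φ : RatFunc ℂ) (z : ℂ) :
    valueAtInfty φ = circleInv z ↔
      conj (φ.denom.coeff (ratDegree φ)) = z * conj (φ.num.coeff (ratDegree φ)) := by
  have hq := φ.monic_denom.coeff_natDegree
  unfold valueAtInfty ratDegree
  split_ifs with h
  · have hp : φ.num.coeff φ.num.natDegree ≠ 0 := by
      rw [coeff_natDegree, Ne, leadingCoeff_eq_zero]
      intro h0
      simp [h0] at h
    rw [max_eq_left h.le, coeff_eq_zero_of_natDegree_lt h, map_zero, eq_comm (a := (0 : ℂ)),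
      mul_eq_zero, map_eq_zero, or_iff_left hp]
    by_cases hz : z = 0
    · simp [hz, circleInv_zero]
    · simp [hz, circleInv_coe hz]
  · rw [max_eq_right (not_lt.1 h), hq, map_one, φ.monic_denom.leadingCoeff, div_one]
    by_cases hz : z = 0
    · simp [hz, circleInv_zero]
    · rw [circleInv_coe hz, OnePoint.coe_eq_coe, eq_div_iff (by simpa using hz)]
      constructor
      · intro h1
        have := congrArg conj h1
        simp only [map_mul, Complex.conj_conj, map_one] at this
        rw [← this, mul_comm]
      · intro h1
        have := congrArg conj h1
        simp only [map_mul, Complex.conj_conj, map_one] at this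
        rw [this, mul_comm]

/-- The cross-multiplied equation needs no exceptions for poles, for `z = 0` or for `u = 0`, so
fibres of the sphere map become root sets of polynomials. -/
theorem exteriorMap_coe_eq_iff (φ : RatFunc ℂ) (u z : ℂ) :
    exteriorMap φ u = z ↔ (extNum φ).eval u = z * (extDenom φ).eval u := by
  rw [exteriorMap_eq_iff_sphereMap_eq]
  by_cases hu : u = 0
  · rw [hu, circleInv_zero, extNum, extDenom, eval_zero_revConj, eval_zero_revConj]
    exact valueAtInfty_eq_circleInv_iff φ z
  · rw [circleInv_coe hu, eval_extNum φ hu, eval_extDenom φ hu, mul_left_comm,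
      mul_right_inj' (pow_ne_zero _ hu)]
    generalize 1 / conj u = x
    by_cases hq : φ.denom.eval x = 0
    · have hp : φ.num.eval x ≠ 0 := fun hp => not_eval_num_eq_zero_and φ x hp hq
      rw [sphereMap_coe_of_eq_zero φ hq, hq, map_zero, eq_comm (a := (0 : ℂ)), mul_eq_zero,
        map_eq_zero, or_iff_left hp]
      by_cases hz : z = 0
      · simp [hz, circleInv_zero]
      · simp [hz, circleInv_coe hz]
    · rw [sphereMap_coe φ hq]
      by_cases hz : z = 0
      · simp [hz, circleInv_zero, hq]
      · have hz' : conj z ≠ 0 := by simpa using hz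
        rw [circleInv_coe hz, OnePoint.coe_eq_coe, div_eq_div_iff hq hz', one_mul]
        constructor
        · intro h1
          rw [← h1, map_mul, Complex.conj_conj, mul_comm]
        · intro h1
          have := congrArg conj h1
          simp only [map_mul, Complex.conj_conj] at this
          rw [this, mul_comm]

/-! ### Rational selfmaps of the disc and their exterior maps -/

section RatSelfMap

variable {φ : RatFunc ℂ}

theorem coe_mem_sphereDisc {z : ℂ} : (z : OnePoint ℂ) ∈ sphereDisc ↔ ‖z‖ < 1 := by
  simp [sphereDisc]

theorem coe_mem_sphereCircle {z : ℂ} : (z : OnePoint ℂ) ∈ sphereCircle ↔ ‖z‖ = 1 := by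
  simp [sphereCircle]

theorem infty_notMem_sphereDisc : OnePoint.infty ∉ sphereDisc := by
  simp [sphereDisc]

theorem IsRatSelfMap.denom_ne_zero (hφ : IsRatSelfMap φ) {z : ℂ} (hz : ‖z‖ < 1) :
    φ.denom.eval z ≠ 0 := fun h => by
  have := hφ (coe_mem_sphereDisc.2 hz)
  rw [sphereMap_coe_of_eq_zero φ h] at this
  exact infty_notMem_sphereDisc this

theorem IsRatSelfMap.norm_num_lt (hφ : IsRatSelfMap φ) {z : ℂ} (hz : ‖z‖ < 1) :
    ‖φ.num.eval z‖ < ‖φ.denom.eval z‖ := by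
  have := hφ (coe_mem_sphereDisc.2 hz)
  have hq := hφ.denom_ne_zero hz
  rw [sphereMap_coe φ hq, coe_mem_sphereDisc, norm_div, div_lt_one (norm_pos_iff.2 hq)] at this
  exact this

theorem IsRatSelfMap.norm_num_le (hφ : IsRatSelfMap φ) {z : ℂ} (hz : ‖z‖ ≤ 1) :
    ‖φ.num.eval z‖ ≤ ‖φ.denom.eval z‖ := by
  have h : z ∈ closure (ball (0 : ℂ) 1) := by
    rw [closure_ball 0 one_ne_zero]
    simpa using hz
  refine le_on_closure (s := ball (0 : ℂ) 1) (f := fun z => ‖φ.num.eval z‖)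
    (g := fun z => ‖φ.denom.eval z‖) (fun w hw => (hφ.norm_num_lt (by simpa using hw)).le)
    (by fun_prop) (by fun_prop) h

theorem IsRatSelfMap.denom_ne_zero' (hφ : IsRatSelfMap φ) {z : ℂ} (hz : ‖z‖ ≤ 1) :
    φ.denom.eval z ≠ 0 := fun h => by
  have := hφ.norm_num_le hz
  rw [h, norm_zero, norm_le_zero_iff] at this
  exact not_eval_num_eq_zero_and φ z this h

theorem IsRatSelfMap.sphereMap_mem_sphereCircle_iff (hφ : IsRatSelfMap φ) {z : ℂ} (hz : ‖z‖ = 1) :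
    sphereMap φ z ∈ sphereCircle ↔ ‖φ.num.eval z‖ = ‖φ.denom.eval z‖ := by
  have hq := hφ.denom_ne_zero' hz.le
  rw [sphereMap_coe φ hq, coe_mem_sphereCircle, norm_div, div_eq_one_iff_eq (norm_ne_zero_iff.2 hq)]

/-- The polynomial whose roots form the fibre of the exterior map over `z`. -/
def fibrePoly (φ : RatFunc ℂ) (z : ℂ) : ℂ[X] := extNum φ - C z * extDenom φ

theorem eval_fibrePoly (z u : ℂ) :
    (fibrePoly φ z).eval u = (extNum φ).eval u - z * (extDenom φ).eval u := by
  simp [fibrePoly]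

theorem natDegree_fibrePoly_le (z : ℂ) : (fibrePoly φ z).natDegree ≤ ratDegree φ :=
  (natDegree_sub_le _ _).trans (max_le (natDegree_revConj_le (le_max_right _ _))
    ((natDegree_C_mul_le _ _).trans (natDegree_revConj_le (le_max_left _ _))))

theorem circleInv_notMem_sphereDisc {z : ℂ} (hz : ‖z‖ ≤ 1) : circleInv z ∉ sphereDisc := by
  by_cases h0 : z = 0
  · rw [h0, circleInv_zero]
    exact infty_notMem_sphereDisc
  · rw [circleInv_coe h0, coe_mem_sphereDisc, norm_div, norm_one, RCLike.norm_conj, not_lt,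
      one_le_div (norm_pos_iff.2 h0)]
    exact hz

/-- The reflected point `1/conj z` is outside the open disc, hence a regular value. -/
theorem encard_roots_fibrePoly (hφ : IsRatSelfMap φ) (hreg : IsOuterRegular φ) {z : ℂ}
    (hz : ‖z‖ ≤ 1) : {u : ℂ | (fibrePoly φ z).eval u = 0}.encard = ratDegree φ := by
  have hr : IsRegularValue φ (circleInv z) := by
    by_contra h
    exact circleInv_notMem_sphereDisc hz (hreg _ h)
  rw [← hr]
  have hmem : ∀ u : ℂ, (fibrePoly φ z).eval u = 0 ↔ sphereMap φ (circleInv u) = circleInv z :=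
    fun u => by
      rw [← exteriorMap_eq_iff_sphereMap_eq, exteriorMap_coe_eq_iff, eval_fibrePoly, sub_eq_zero]
  have hset : sphereMap φ ⁻¹' {circleInv z} =
      (fun u : ℂ => circleInv u) '' {u : ℂ | (fibrePoly φ z).eval u = 0} := by
    ext x
    simp only [mem_preimage, mem_singleton_iff, mem_image, mem_ofPred_eq, hmem]
    constructor
    · intro hx
      -- A fibre point at infinity would mean that `φ(0)` is the reflection of `z`, but `φ(0)` lies
      -- in the open disc.
      induction h : circleInv x using OnePoint.rec with
      | infty =>
        exfalso
        have hx0 : x = ((0 : ℂ) : OnePoint ℂ) := by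
          rw [← circleInv_circleInv x, h, circleInv_infty]
        refine circleInv_notMem_sphereDisc hz (hx ▸ hφ ?_)
        rw [hx0, coe_mem_sphereDisc]
        simp
      | coe u =>
        refine ⟨u, ?_, ?_⟩
        · rw [← h, circleInv_circleInv, hx]
        · rw [← h, circleInv_circleInv]
    · rintro ⟨u, hu, rfl⟩
      exact hu
  rw [hset, Function.Injective.encard_image]
  intro u v huv
  have := congrArg circleInv huv
  simpa only [circleInv_circleInv, OnePoint.coe_eq_coe] using this

theorem fibrePoly_ne_zero (hφ : IsRatSelfMap φ) (hreg : IsOuterRegular φ) {z : ℂ} (hz : ‖z‖ ≤ 1) :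
    fibrePoly φ z ≠ 0 := fun h => by
  have := encard_roots_fibrePoly hφ hreg hz
  simp only [h, eval_zero, ofPred_true] at this
  have h2 : (univ : Set ℂ).Finite := finite_of_encard_eq_coe this
  exact infinite_univ h2

theorem exists_finset_roots_fibrePoly (hφ : IsRatSelfMap φ) (hreg : IsOuterRegular φ) {z : ℂ}
    (hz : ‖z‖ ≤ 1) :
    ∃ S : Finset ℂ, S.card = ratDegree φ ∧ ∀ u, u ∈ S ↔ (fibrePoly φ z).eval u = 0 := by
  have h := encard_roots_fibrePoly hφ hreg hz
  have hfin := finite_of_encard_eq_coe h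
  refine ⟨hfin.toFinset, ?_, fun u => by simp⟩
  rw [hfin.encard_eq_coe_toFinset_card] at h
  exact_mod_cast h

theorem derivative_fibrePoly_ne_zero (hφ : IsRatSelfMap φ) (hreg : IsOuterRegular φ) {z u : ℂ}
    (hz : ‖z‖ ≤ 1) (hu : (fibrePoly φ z).eval u = 0) : (fibrePoly φ z).derivative.eval u ≠ 0 := by
  obtain ⟨S, hS, hmem⟩ := exists_finset_roots_fibrePoly hφ hreg hz
  exact derivative_eval_ne_zero_of_card_eq (fibrePoly_ne_zero hφ hreg hz)
    (natDegree_fibrePoly_le z) hS (fun u hu => (hmem u).1 hu) ((hmem u).2 hu)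

theorem eval_fibrePoly_of_ne_zero (z : ℂ) {u : ℂ} (hu : u ≠ 0) :
    (fibrePoly φ z).eval u = u ^ ratDegree φ *
      (conj (φ.denom.eval (1 / conj u)) - z * conj (φ.num.eval (1 / conj u))) := by
  rw [eval_fibrePoly, eval_extNum φ hu, eval_extDenom φ hu]
  ring

theorem norm_denom_eq_of_root {z u : ℂ} (hu : (fibrePoly φ z).eval u = 0) (hu0 : u ≠ 0) :
    ‖φ.denom.eval (1 / conj u)‖ = ‖z‖ * ‖φ.num.eval (1 / conj u)‖ := by
  rw [eval_fibrePoly_of_ne_zero z hu0, mul_eq_zero, or_iff_right (pow_ne_zero _ hu0),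
    sub_eq_zero] at hu
  have := congrArg norm hu
  rwa [norm_mul, RCLike.norm_conj, RCLike.norm_conj] at this

/-- If `|u| > 1`, then `1/conj u` is in the disc, where `|p| < |q|`; but the root equation gives
`|q| = |z||p| ≤ |p|` there. -/
theorem IsRatSelfMap.norm_root_le (hφ : IsRatSelfMap φ) {z u : ℂ} (hz : ‖z‖ ≤ 1)
    (hu : (fibrePoly φ z).eval u = 0) : ‖u‖ ≤ 1 := by
  by_contra! h
  have hu0 : u ≠ 0 := norm_pos_iff.1 (one_pos.trans h)
  have h1 := norm_denom_eq_of_root hu hu0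
  have hx : ‖1 / conj u‖ < 1 := by
    rw [norm_div, norm_one, RCLike.norm_conj]
    exact (div_lt_one (one_pos.trans h)).2 h
  have h2 := hφ.norm_num_lt hx
  nlinarith [norm_nonneg (φ.num.eval (1 / conj u))]

theorem one_div_conj_of_norm_eq_one {u : ℂ} (hu : ‖u‖ = 1) : 1 / conj u = u := by
  have h0 : conj u ≠ 0 := by
    rw [Ne, map_eq_zero]
    rintro rfl
    simp at hu
  rw [div_eq_iff h0, Complex.mul_conj, Complex.normSq_eq_norm_sq, hu]
  simp

/-- On the circle `u` is its own reflection, and `|q| = |z||p| ≤ |p| ≤ |q|` forces equality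
throughout. -/
theorem IsRatSelfMap.norm_eq_of_root (hφ : IsRatSelfMap φ) {z u : ℂ} (hz : ‖z‖ ≤ 1)
    (hu : (fibrePoly φ z).eval u = 0) (hu1 : ‖u‖ = 1) :
    ‖φ.num.eval u‖ = ‖φ.denom.eval u‖ ∧ ‖z‖ = 1 := by
  have hu0 : u ≠ 0 := norm_pos_iff.1 (by rw [hu1]; exact one_pos)
  have h1 := norm_denom_eq_of_root hu hu0
  rw [one_div_conj_of_norm_eq_one hu1] at h1
  have h2 := hφ.norm_num_le hu1.le
  have h3 := norm_pos_iff.2 (hφ.denom_ne_zero' hu1.le)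
  have h4 := norm_nonneg (φ.num.eval u)
  have h5 : ‖φ.num.eval u‖ = ‖φ.denom.eval u‖ := by nlinarith
  refine ⟨h5, ?_⟩
  rw [h5] at h1
  nlinarith

theorem IsRatSelfMap.norm_root_lt (hφ : IsRatSelfMap φ) {z u : ℂ} (hz : ‖z‖ < 1)
    (hu : (fibrePoly φ z).eval u = 0) : ‖u‖ < 1 :=
  (hφ.norm_root_le hz.le hu).lt_of_ne fun h => hz.ne (hφ.norm_eq_of_root hz.le hu h).2

/-- The exterior map as a function on the plane. -/
def extFun (φ : RatFunc ℂ) (u : ℂ) : ℂ := (extNum φ).eval u / (extDenom φ).eval u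

/-- The Wronskian of the numerator and the denominator of the exterior map. -/
def extWronskian (φ : RatFunc ℂ) : ℂ[X] :=
  (extNum φ).derivative * extDenom φ - extNum φ * (extDenom φ).derivative

/-- The points of the plane where the exterior map is finite and locally invertible. -/
def extDomain (φ : RatFunc ℂ) : Set ℂ :=
  {u | (extDenom φ).eval u ≠ 0 ∧ (extWronskian φ).eval u ≠ 0}

theorem isOpen_extDomain : IsOpen (extDomain φ) :=
  (isOpen_ne_fun (by fun_prop) continuous_const).inter (isOpen_ne_fun (by fun_prop) continuous_const)

theorem hasStrictDerivAt_extFun {u : ℂ} (hu : u ∈ extDomain φ) :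
    HasStrictDerivAt (extFun φ) ((extWronskian φ).eval u / (extDenom φ).eval u ^ 2) u := by
  have := ((extNum φ).hasStrictDerivAt u).div ((extDenom φ).hasStrictDerivAt u) hu.1
  have e : (extWronskian φ).eval u = (extNum φ).derivative.eval u * (extDenom φ).eval u -
      (extNum φ).eval u * (extDenom φ).derivative.eval u := by simp [extWronskian]
  rw [e]
  exact this

theorem extDeriv_ne_zero {u : ℂ} (hu : u ∈ extDomain φ) :
    (extWronskian φ).eval u / (extDenom φ).eval u ^ 2 ≠ 0 :=
  div_ne_zero hu.2 (pow_ne_zero _ hu.1)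

theorem eval_fibrePoly_eq_zero_iff {z u : ℂ} (hu : (extDenom φ).eval u ≠ 0) :
    (fibrePoly φ z).eval u = 0 ↔ extFun φ u = z := by
  rw [eval_fibrePoly, sub_eq_zero, extFun, div_eq_iff hu]

theorem extDenom_ne_zero_of_root {z u : ℂ} (hu : (fibrePoly φ z).eval u = 0) :
    (extDenom φ).eval u ≠ 0 := fun h => by
  rw [eval_fibrePoly, h, mul_zero, sub_zero] at hu
  exact not_eval_extNum_eq_zero_and φ u hu h

theorem derivative_fibrePoly_eq {z u : ℂ} (hu : (fibrePoly φ z).eval u = 0) :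
    (fibrePoly φ z).derivative.eval u = (extWronskian φ).eval u / (extDenom φ).eval u := by
  have h := extDenom_ne_zero_of_root hu
  rw [eq_div_iff h]
  rw [eval_fibrePoly] at hu
  simp only [fibrePoly, extWronskian, derivative_sub, derivative_C_mul, eval_sub, eval_mul, eval_C]
  linear_combination (extDenom φ).derivative.eval u * hu

theorem mem_extDomain_of_root (hφ : IsRatSelfMap φ) (hreg : IsOuterRegular φ) {z u : ℂ}
    (hz : ‖z‖ ≤ 1) (hu : (fibrePoly φ z).eval u = 0) : u ∈ extDomain φ := by
  refine ⟨extDenom_ne_zero_of_root hu, fun h => derivative_fibrePoly_ne_zero hφ hreg hz hu ?_⟩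
  rw [derivative_fibrePoly_eq hu, h, zero_div]

/-- Outer regularity makes membership in the open set `extDomain φ` automatic over the closed disc;
what remains is a closed condition, whence compactness. -/
theorem mem_preimage_iff (hφ : IsRatSelfMap φ) (hreg : IsOuterRegular φ) {u : ℂ} :
    u ∈ extDomain φ ∩ extFun φ ⁻¹' closedBall 0 1 ↔
      ‖(extNum φ).eval u‖ ≤ ‖(extDenom φ).eval u‖ := by
  constructor
  · rintro ⟨h1, h2⟩
    rwa [mem_preimage, mem_closedBall_zero_iff, extFun, norm_div,
      div_le_one (norm_pos_iff.2 h1.1)] at h2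
  · intro h
    have h0 : (extDenom φ).eval u ≠ 0 := fun h0 => by
      rw [h0, norm_zero, norm_le_zero_iff] at h
      exact not_eval_extNum_eq_zero_and φ u h h0
    have h1 : ‖extFun φ u‖ ≤ 1 := by
      rwa [extFun, norm_div, div_le_one (norm_pos_iff.2 h0)]
    exact ⟨mem_extDomain_of_root hφ hreg h1 ((eval_fibrePoly_eq_zero_iff h0).2 rfl), by simpa⟩

theorem isCompact_preimage (hφ : IsRatSelfMap φ) (hreg : IsOuterRegular φ) :
    IsCompact (extDomain φ ∩ extFun φ ⁻¹' closedBall 0 1) := by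
  refine (isCompact_closedBall (0 : ℂ) 1).of_isClosed_subset ?_ ?_
  · have : extDomain φ ∩ extFun φ ⁻¹' closedBall 0 1 =
        {u | ‖(extNum φ).eval u‖ ≤ ‖(extDenom φ).eval u‖} := by
      ext u
      exact mem_preimage_iff hφ hreg
    rw [this]
    exact isClosed_le (by fun_prop) (by fun_prop)
  · rintro u ⟨h1, h2⟩
    rw [mem_closedBall_zero_iff]
    exact hφ.norm_root_le (by simpa using h2) ((eval_fibrePoly_eq_zero_iff h1.1).2 rfl)

/-! ### The adjoint on monomials -/

/-- The function `F / F'`, for the exterior map `F`. -/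
def extWeight (φ : RatFunc ℂ) (u : ℂ) : ℂ :=
  (extNum φ).eval u * (extDenom φ).eval u / (extWronskian φ).eval u

theorem continuousOn_extWeight : ContinuousOn (extWeight φ) (extDomain φ) :=
  ContinuousOn.div (by fun_prop) (by fun_prop) fun _ hu => hu.2

/-- Partial fractions of `N/(N - zD)` at `x = 1/conj w`. At a root `u` the residue `N/(N - zD)'`
equals `F/F'`, and `1/(x - u) = conj w/(1 - u conj w)` expands geometrically. -/
theorem hasSum_kernel_comp (hφ : IsRatSelfMap φ) (hreg : IsOuterRegular φ) {z : ℂ} (hz : ‖z‖ < 1)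
    {S : Finset ℂ} (hS : S.card = ratDegree φ) (hmem : ∀ u, u ∈ S ↔ (fibrePoly φ z).eval u = 0)
    {w : ℂ} (hw : ‖w‖ < 1) :
    HasSum (fun n : ℕ => (if n = 0 then
        (extNum φ).coeff (ratDegree φ) / (fibrePoly φ z).coeff (ratDegree φ)
        else ∑ u ∈ S, extWeight φ u * u ^ (n - 1)) * conj w ^ n)
      (1 / (1 - z * conj (φ.num.eval w / φ.denom.eval w))) := by
  have hsum := hasSum_simple_fractions (S := S) (fun u hu => hφ.norm_root_lt hz ((hmem u).1 hu))
    ((extNum φ).coeff (ratDegree φ) / (fibrePoly φ z).coeff (ratDegree φ)) (extWeight φ)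
    (v := conj w) (by simpa using hw)
  convert hsum using 1
  have hq : conj (φ.denom.eval w) ≠ 0 := by simpa using hφ.denom_ne_zero hw
  have hne : conj (φ.denom.eval w) - z * conj (φ.num.eval w) ≠ 0 := fun h => by
    have h1 := congrArg norm (sub_eq_zero.1 h)
    rw [norm_mul, RCLike.norm_conj, RCLike.norm_conj] at h1
    have h2 := hφ.norm_num_lt hw
    nlinarith [norm_nonneg (φ.num.eval w), norm_nonneg z]
  have hlhs : 1 / (1 - z * conj (φ.num.eval w / φ.denom.eval w)) =
      conj (φ.denom.eval w) / (conj (φ.denom.eval w) - z * conj (φ.num.eval w)) := by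
    rw [map_div₀, div_eq_div_iff _ hne]
    · field_simp
    · intro h
      apply hne
      field_simp at h
      simpa using h
  rw [hlhs]
  -- Here `x` is the point at infinity, where only the ratio of the coefficients of index `d`
  -- survives.
  by_cases hw0 : w = 0
  · subst hw0
    simp only [map_zero, zero_mul, mul_zero, Finset.sum_const_zero, add_zero]
    simp only [fibrePoly, coeff_sub, coeff_C_mul, extNum, extDenom, coeff_revConj,
      coeff_zero_eq_eval_zero]
  · have hx0 : 1 / conj w ≠ 0 := by simpa using hw0
    have hxw : 1 / conj (1 / conj w) = w := by simp
    have hpow := pow_ne_zero (ratDegree φ) hx0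
    have hDx := eval_fibrePoly_of_ne_zero (φ := φ) z hx0
    have hQx := eval_extNum φ hx0
    rw [hxw] at hDx hQx
    have hpf := eval_div_eval_eq_add_sum (Q := extNum φ) (D := fibrePoly φ z)
      (natDegree_revConj_le (le_max_right _ _)) (fibrePoly_ne_zero hφ hreg hz.le)
      (natDegree_fibrePoly_le z) hS (fun u hu => (hmem u).1 hu) (x := 1 / conj w)
      (by rw [hDx]; exact mul_ne_zero hpow hne)
    rw [hDx, hQx, mul_div_mul_left _ _ hpow] at hpf
    rw [hpf]
    congr 1
    refine Finset.sum_congr rfl fun u hu => ?_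
    have hu' := (hmem u).1 hu
    have hw' : conj w ≠ 0 := by simpa using hw0
    congr 1
    · rw [derivative_fibrePoly_eq hu', extWeight, div_div_eq_mul_div]
    · rw [← inv_inv (conj w), ← mul_inv, inv_inv]
      congr 1
      field_simp

theorem adjoint_monom_apply (hφ : IsRatSelfMap φ) (hreg : IsOuterRegular φ) {Cφ : H2 →L[ℂ] H2}
    (hC : IsCompositionOp (fun z => φ.eval (RingHom.id ℂ) z) Cφ) {z : ℂ} (hz : ‖z‖ < 1)
    {S : Finset ℂ} (hS : S.card = ratDegree φ) (hmem : ∀ u, u ∈ S ↔ (fibrePoly φ z).eval u = 0)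
    (n : ℕ) :
    ContinuousLinearMap.adjoint Cφ (monom (n + 1)) z = ∑ u ∈ S, extWeight φ u * u ^ n := by
  have hzU : z ∈ unitDisc := by simpa using hz
  obtain ⟨k, hk, hkv⟩ := exists_kernel hzU
  rw [← hk, ContinuousLinearMap.adjoint_inner_right, ← inner_conj_symm, inner_monom]
  have h : ∀ w ∈ unitDisc, HasSum (fun n : ℕ => conj (if n = 0 then
        (extNum φ).coeff (ratDegree φ) / (fibrePoly φ z).coeff (ratDegree φ)
        else ∑ u ∈ S, extWeight φ u * u ^ (n - 1)) * w ^ n) (Cφ k w) := fun w hw => by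
    have hw' := norm_lt_one_of_mem hw
    have h1 := Complex.hasSum_conj'.2 (hasSum_kernel_comp hφ hreg hz hS hmem hw')
    simp only [map_mul, map_pow, Complex.conj_conj] at h1
    convert h1 using 1
    rw [hC k w hw]
    have hφw : φ.num.eval w / φ.denom.eval w ∈ unitDisc := by
      rw [mem_ball_zero_iff, norm_div,
        div_lt_one (norm_pos_iff.2 (hφ.denom_ne_zero hw'))]
      exact hφ.norm_num_lt hw'
    refine (hkv _ hφw).trans ?_
    simp
  rw [macCoeff_eq_of_hasSum h]
  simp

end RatSelfMap

/-! ### The inverse branch through the contact point -/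

section Branch

variable {φ : RatFunc ℂ}

/-- A continuous branch of the inverse of the exterior map on the closed disc that takes the value
`ζ` at the boundary. -/
structure IsExtBranch (φ : RatFunc ℂ) (ζ : ℂ) (σ : ℂ → ℂ) : Prop where
  continuousOn : ContinuousOn σ (closedBall 0 1)
  apply_extFun : σ (extFun φ ζ) = ζ
  mem : ∀ z ∈ closedBall (0 : ℂ) 1, σ z ∈ extDomain φ
  extFun_apply : ∀ z ∈ closedBall (0 : ℂ) 1, extFun φ (σ z) = z

theorem exists_isExtBranch (hφ : IsRatSelfMap φ) (hreg : IsOuterRegular φ) {ζ : ℂ} (hζ : ‖ζ‖ = 1)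
    (hζ' : ‖φ.num.eval ζ‖ = ‖φ.denom.eval ζ‖) : ∃ σ, IsExtBranch φ ζ σ := by
  have hK : ζ ∈ extDomain φ ∩ extFun φ ⁻¹' closedBall 0 1 := by
    have hζ0 : ζ ≠ 0 := norm_pos_iff.1 (by rw [hζ]; exact one_pos)
    rw [mem_preimage_iff hφ hreg, eval_extNum φ hζ0, eval_extDenom φ hζ0,
      one_div_conj_of_norm_eq_one hζ]
    simp [hζ']
  obtain ⟨σ, h1, h2, h3⟩ := exists_continuousOn_branch isOpen_extDomain
    (fun u hu => hasStrictDerivAt_extFun hu) (fun u hu => extDeriv_ne_zero hu)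
    (isCompact_preimage hφ hreg) hK.1 hK.2
  exact ⟨σ, h1, h2, fun z hz => (h3 z hz).1, fun z hz => (h3 z hz).2⟩

namespace IsExtBranch

variable {ζ : ℂ} {σ : ℂ → ℂ}

theorem eval_fibrePoly (h : IsExtBranch φ ζ σ) {z : ℂ} (hz : z ∈ closedBall (0 : ℂ) 1) :
    (fibrePoly φ z).eval (σ z) = 0 :=
  (eval_fibrePoly_eq_zero_iff (h.mem z hz).1).2 (h.extFun_apply z hz)

theorem mem_preimage (h : IsExtBranch φ ζ σ) {z : ℂ} (hz : z ∈ closedBall (0 : ℂ) 1) :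
    σ z ∈ extDomain φ ∩ extFun φ ⁻¹' closedBall 0 1 :=
  ⟨h.mem z hz, by rw [Set.mem_preimage, h.extFun_apply z hz]; exact hz⟩

theorem hasDerivAt (h : IsExtBranch φ ζ σ) {z : ℂ} (hz : z ∈ unitDisc) :
    HasDerivAt σ ((extWronskian φ).eval (σ z) / (extDenom φ).eval (σ z) ^ 2)⁻¹ z :=
  hasDerivAt_branch (F := extFun φ)
    (F' := fun u => (extWronskian φ).eval u / (extDenom φ).eval u ^ 2)
    (fun _ hu => hasStrictDerivAt_extFun hu) (fun _ hu => extDeriv_ne_zero hu) h.continuousOn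
    (fun z hz => ⟨h.mem z hz, h.extFun_apply z hz⟩) hz

theorem differentiableOn (h : IsExtBranch φ ζ σ) : DifferentiableOn ℂ σ unitDisc :=
  fun _ hz => (h.hasDerivAt hz).differentiableAt.differentiableWithinAt

/-- `F(σ(z)) = z` gives `σ' = 1/F'(σ)`, so `zσ'` is `F/F'` at `σ(z)`. This turns the weight in the
adjoint formula into `h`. -/
theorem mul_deriv (h : IsExtBranch φ ζ σ) {z : ℂ} (hz : z ∈ unitDisc) :
    z * deriv σ z = extWeight φ (σ z) := by
  have hz' := ball_subset_closedBall hz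
  have h1 := h.mem z hz'
  have h2 : (extNum φ).eval (σ z) = z * (extDenom φ).eval (σ z) := by
    rw [← sub_eq_zero, ← AdjointComp.eval_fibrePoly]
    exact h.eval_fibrePoly hz'
  rw [(h.hasDerivAt hz).deriv, extWeight, h2]
  have := h1.1
  have := h1.2
  field_simp

theorem mapsTo (h : IsExtBranch φ ζ σ) (hφ : IsRatSelfMap φ) : MapsTo σ unitDisc unitDisc :=
  fun _ hz => mem_ball_zero_iff.2
    (hφ.norm_root_lt (norm_lt_one_of_mem hz) (h.eval_fibrePoly (ball_subset_closedBall hz)))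

theorem isInverseBranch (h : IsExtBranch φ ζ σ) :
    IsInverseBranch (exteriorMap φ) σ unitDisc := by
  have hext : ∀ z ∈ unitDisc, exteriorMap φ (σ z) = z := fun z hz => by
    rw [exteriorMap_coe_eq_iff, ← sub_eq_zero, ← AdjointComp.eval_fibrePoly]
    exact h.eval_fibrePoly (ball_subset_closedBall hz)
  refine ⟨(fun z : ℂ => (σ z : OnePoint ℂ)) '' unitDisc, ?_, ?_,
    fun z hz => ⟨mem_image_of_mem _ hz, hext z hz⟩⟩
  · rintro _ ⟨z, hz, rfl⟩ _ ⟨w, hw, rfl⟩ hzw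
    rw [hext z hz, hext w hw, OnePoint.coe_eq_coe] at hzw
    rw [hzw]
  · rw [image_image]
    exact image_congr hext

/-- The other points of the fibres stay away from the unit circle. -/
theorem exists_radius (h : IsExtBranch φ ζ σ) (hφ : IsRatSelfMap φ) (hreg : IsOuterRegular φ)
    (hone : ∀ ξ : ℂ, ‖ξ‖ = 1 → ‖φ.num.eval ξ‖ = ‖φ.denom.eval ξ‖ → ξ = ζ) :
    ∃ r : ℝ, 0 ≤ r ∧ r < 1 ∧ ∀ z ∈ closedBall (0 : ℂ) 1, ∀ u, (fibrePoly φ z).eval u = 0 →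
      u ≠ σ z → ‖u‖ ≤ r := by
  have hT := isCompact_off_branch (F := extFun φ)
    (F' := fun u => (extWronskian φ).eval u / (extDenom φ).eval u ^ 2)
    (fun _ hu => hasStrictDerivAt_extFun hu) (fun _ hu => extDeriv_ne_zero hu)
    (isCompact_preimage hφ hreg) h.continuousOn
    (fun z hz => ⟨h.mem z hz, h.extFun_apply z hz⟩)
  set T := {u | u ∈ extDomain φ ∩ extFun φ ⁻¹' closedBall 0 1 ∧ σ (extFun φ u) ≠ u} with hTdef
  -- A point of `T` on the circle would be `ζ` by uniqueness of the contact point, but `ζ` is on the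
  -- branch.
  have hlt : ∀ u ∈ T, ‖u‖ < 1 := by
    rintro u ⟨⟨hu1, hu2⟩, hu3⟩
    have hu2' : ‖extFun φ u‖ ≤ 1 := by simpa using hu2
    have hroot : (fibrePoly φ (extFun φ u)).eval u = 0 :=
      (eval_fibrePoly_eq_zero_iff hu1.1).2 rfl
    refine (hφ.norm_root_le hu2' hroot).lt_of_ne fun hu4 => hu3 ?_
    rw [hone u hu4 (hφ.norm_eq_of_root hu2' hroot hu4).1]
    exact h.apply_extFun
  have hmemT : ∀ z ∈ closedBall (0 : ℂ) 1, ∀ u, (fibrePoly φ z).eval u = 0 → u ≠ σ z → u ∈ T := by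
    intro z hz u hu hne
    have hE := mem_extDomain_of_root hφ hreg (by simpa using hz) hu
    have hFu := (eval_fibrePoly_eq_zero_iff hE.1).1 hu
    exact ⟨⟨hE, by rw [Set.mem_preimage, hFu]; exact hz⟩, by rw [hFu]; exact hne.symm⟩
  rcases T.eq_empty_or_nonempty with hemp | hne
  · exact ⟨0, le_rfl, one_pos, fun z hz u hu hne => absurd (hmemT z hz u hu hne) (by simp [hemp])⟩
  · obtain ⟨u₀, hu₀, hmax⟩ := hT.exists_isMaxOn hne continuous_norm.continuousOn
    exact ⟨‖u₀‖, norm_nonneg _, hlt u₀ hu₀, fun z hz u hu hne => hmax (hmemT z hz u hu hne)⟩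

/-- The adjoint of `C_φ` differs little from `M_h C_σ B` on high powers. -/
theorem summable_norm_apply_monom (h : IsExtBranch φ ζ σ) (hφ : IsRatSelfMap φ)
    (hreg : IsOuterRegular φ)
    (hone : ∀ ξ : ℂ, ‖ξ‖ = 1 → ‖φ.num.eval ξ‖ = ‖φ.denom.eval ξ‖ → ξ = ζ) {Cφ : H2 →L[ℂ] H2}
    (hC : IsCompositionOp (fun z => φ.eval (RingHom.id ℂ) z) Cφ) {T : H2 →L[ℂ] H2}
    (hT : ∀ n, ∀ z ∈ unitDisc, T (monom (n + 1)) z = extWeight φ (σ z) * σ z ^ n) :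
    Summable fun n => ‖(ContinuousLinearMap.adjoint Cφ - T) (monom n)‖ := by
  classical
  obtain ⟨r, hr0, hr1, hr⟩ := h.exists_radius hφ hreg hone
  obtain ⟨M, hM⟩ := (isCompact_preimage hφ hreg).exists_bound_of_continuousOn
    (continuousOn_extWeight.mono inter_subset_left)
  -- The constant monomial is dropped: a single term does not affect summability.
  rw [← summable_nat_add_iff 1]
  refine Summable.of_nonneg_of_le (fun n => norm_nonneg _) (fun n => ?_)
    ((summable_geometric_of_lt_one hr0 hr1).mul_left (ratDegree φ * M))
  refine norm_le_of_forall_norm_le fun z hz => ?_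
  have hz1 := norm_lt_one_of_mem hz
  have hzc := ball_subset_closedBall hz
  obtain ⟨S, hS, hmem⟩ := exists_finset_roots_fibrePoly hφ hreg hz1.le
  -- The fibre point `σ z` contributes exactly the value of `T`; only the other points, with `|u| ≤
  -- r`, remain.
  rw [sub_apply, H2.sub_apply, hT n z hz,
    adjoint_monom_apply hφ hreg hC hz1 hS hmem n,
    ← Finset.add_sum_erase S _ ((hmem _).2 (h.eval_fibrePoly hzc)), add_sub_cancel_left]
  have hterm : ∀ u ∈ S.erase (σ z), ‖extWeight φ u * u ^ n‖ ≤ M * r ^ n := fun u hu => by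
    have hu1 := Finset.ne_of_mem_erase hu
    have hu2 := (hmem u).1 (Finset.mem_of_mem_erase hu)
    have hE := mem_extDomain_of_root hφ hreg hz1.le hu2
    have hFu := (eval_fibrePoly_eq_zero_iff hE.1).1 hu2
    have hw := hM u ⟨hE, by rw [Set.mem_preimage, hFu]; exact hzc⟩
    rw [norm_mul, norm_pow]
    exact mul_le_mul hw (pow_le_pow_left₀ (norm_nonneg _) (hr z hzc u hu2 hu1) n)
      (by positivity) ((norm_nonneg _).trans hw)
  refine (norm_sum_le_of_le _ hterm).trans ?_
  rw [Finset.sum_const, nsmul_eq_mul, ← hS, mul_assoc]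
  have hM0 : 0 ≤ M := (norm_nonneg _).trans (hM _ (h.mem_preimage hzc))
  gcongr
  exact Finset.erase_subset _ _

end IsExtBranch

/-- If `0` were in the fibre over `z`, then `φ(∞)` would be the reflection of `z`, outside the open
disc. -/
theorem IsStronglyOuterRegular.zero_notMem (hs : IsStronglyOuterRegular φ) :
    (0 : ℂ) ∉ extDomain φ ∩ extFun φ ⁻¹' closedBall 0 1 := by
  intro h
  have hz : ‖extFun φ 0‖ ≤ 1 := by simpa using h.2
  have h0 : (fibrePoly φ (extFun φ 0)).eval 0 = 0 := (eval_fibrePoly_eq_zero_iff h.1.1).2 rfl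
  rw [eval_fibrePoly, sub_eq_zero, ← exteriorMap_coe_eq_iff, exteriorMap_eq_iff_sphereMap_eq,
    circleInv_zero] at h0
  exact circleInv_notMem_sphereDisc hz (h0 ▸ hs.2)

theorem isBoundedHolomorphic_of_eqOn {g G σ : ℂ → ℂ} {K : Set ℂ} (hK : IsCompact K)
    (hG : ContinuousOn G K) (hσ : MapsTo σ unitDisc K) (hd : DifferentiableOn ℂ g unitDisc)
    (hg : ∀ z ∈ unitDisc, g z = G (σ z)) : IsBoundedHolomorphic g := by
  obtain ⟨M, hM⟩ := hK.exists_bound_of_continuousOn hG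
  exact ⟨hd, M, fun z hz => by rw [hg z hz]; exact hM _ (hσ hz)⟩

theorem IsRatSelfMap.exists_compositionOp (hφ : IsRatSelfMap φ) :
    ∃ Cφ : H2 →L[ℂ] H2, IsCompositionOp (fun z => φ.eval (RingHom.id ℂ) z) Cφ := by
  refine AdjointComp.exists_compositionOp (ψ := fun z => φ.num.eval z / φ.denom.eval z) ?_ ?_
  · exact DifferentiableOn.div (by fun_prop) (by fun_prop)
      fun z hz => hφ.denom_ne_zero (norm_lt_one_of_mem hz)
  · intro z hz
    have hz' := norm_lt_one_of_mem hz
    rw [mem_ball_zero_iff, norm_div, div_lt_one (norm_pos_iff.2 (hφ.denom_ne_zero hz'))]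
    exact hφ.norm_num_lt hz'

end Branch

end AdjointComp
end

theorem corollary5p2 (φ : RatFunc ℂ) (hφ : AdjointComp.IsRatSelfMap φ)
    (hreg : AdjointComp.IsOuterRegular φ)
    (hone : ∃! ζ : ℂ, ζ ∈ Metric.sphere (0 : ℂ) 1 ∧
      AdjointComp.sphereMap φ (ζ : OnePoint ℂ) ∈ AdjointComp.sphereCircle) :
    ∃ Cφ : AdjointComp.H2 →L[ℂ] AdjointComp.H2,
      AdjointComp.IsCompositionOp (fun z => φ.eval (RingHom.id ℂ) z) Cφ ∧
    ∃ B : AdjointComp.H2 →L[ℂ] AdjointComp.H2, AdjointComp.IsBackwardShift B ∧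
    ∃ σ : ℂ → ℂ,
      DifferentiableOn ℂ σ AdjointComp.unitDisc ∧
      Set.MapsTo σ AdjointComp.unitDisc AdjointComp.unitDisc ∧
      AdjointComp.IsInverseBranch (AdjointComp.exteriorMap φ) σ AdjointComp.unitDisc ∧
    ∃ Cσ : AdjointComp.H2 →L[ℂ] AdjointComp.H2, AdjointComp.IsCompositionOp σ Cσ ∧
      (AdjointComp.IsBoundedHolomorphic (fun z => z * deriv σ z) ∧
        ∃ Mh : AdjointComp.H2 →L[ℂ] AdjointComp.H2,
          AdjointComp.IsMultiplicationOp (fun z => z * deriv σ z) Mh ∧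
          IsCompactOperator
            (ContinuousLinearMap.adjoint Cφ - Mh ∘L Cσ ∘L B :
              AdjointComp.H2 →L[ℂ] AdjointComp.H2)) ∧
      (AdjointComp.IsStronglyOuterRegular φ →
        (∀ z ∈ AdjointComp.unitDisc, σ z ≠ 0) ∧
        AdjointComp.IsBoundedHolomorphic (fun z => z * deriv σ z / σ z) ∧
        ∃ Mg : AdjointComp.H2 →L[ℂ] AdjointComp.H2,
          AdjointComp.IsMultiplicationOp (fun z => z * deriv σ z / σ z) Mg ∧
          IsCompactOperator
            (ContinuousLinearMap.adjoint Cφ - Mg ∘L Cσ :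
              AdjointComp.H2 →L[ℂ] AdjointComp.H2)) := by
  open AdjointComp in
  obtain ⟨ζ, ⟨hζ, hζφ⟩, huniq⟩ := hone
  rw [mem_sphere_zero_iff_norm] at hζ
  rw [hφ.sphereMap_mem_sphereCircle_iff hζ] at hζφ
  have hone : ∀ ξ : ℂ, ‖ξ‖ = 1 → ‖φ.num.eval ξ‖ = ‖φ.denom.eval ξ‖ → ξ = ζ := fun ξ h1 h2 =>
    huniq ξ ⟨mem_sphere_zero_iff_norm.2 h1, (hφ.sphereMap_mem_sphereCircle_iff h1).2 h2⟩
  obtain ⟨σ, h⟩ := exists_isExtBranch hφ hreg hζ hζφ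
  obtain ⟨Cφ, hC⟩ := hφ.exists_compositionOp
  obtain ⟨B, hB, hBn⟩ := exists_backwardShift
  have hmaps := h.mapsTo hφ
  obtain ⟨Cσ, hCσ⟩ := exists_compositionOp h.differentiableOn hmaps
  have hK := isCompact_preimage hφ hreg
  have hσK : MapsTo σ unitDisc (extDomain φ ∩ extFun φ ⁻¹' closedBall 0 1) :=
    fun z hz => h.mem_preimage (ball_subset_closedBall hz)
  have hwc : ContinuousOn (extWeight φ) (extDomain φ ∩ extFun φ ⁻¹' closedBall 0 1) :=
    continuousOn_extWeight.mono inter_subset_left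
  have hhd : DifferentiableOn ℂ (fun z => z * deriv σ z) unitDisc :=
    differentiableOn_id.mul (h.differentiableOn.deriv isOpen_ball)
  have hh := isBoundedHolomorphic_of_eqOn hK hwc hσK hhd fun z hz => h.mul_deriv hz
  refine ⟨Cφ, hC, B, hB, σ, h.differentiableOn, hmaps, h.isInverseBranch, Cσ, hCσ, ⟨hh, ?_⟩,
    fun hs => ?_⟩
  · obtain ⟨M, hM⟩ := hh.2
    obtain ⟨Mh, hMh, -⟩ := exists_multiplicationOp hhd hM
    refine ⟨Mh, hMh, isCompactOperator_of_summable
      (h.summable_norm_apply_monom hφ hreg hone hC fun n z hz => ?_)⟩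
    rw [ContinuousLinearMap.comp_apply, ContinuousLinearMap.comp_apply, hMh _ z hz, hCσ _ z hz,
      hBn, monom_apply n (hmaps hz)]
    exact congrArg (· * σ z ^ n) (h.mul_deriv hz)
  · have h0 := hs.zero_notMem
    have hσ0 : ∀ z ∈ unitDisc, σ z ≠ 0 := fun z hz hz0 => h0 (hz0 ▸ hσK hz)
    have hgd : DifferentiableOn ℂ (fun z => z * deriv σ z / σ z) unitDisc :=
      hhd.div h.differentiableOn hσ0
    -- `F/F'` divided by `u` is still continuous on the compact preimage, which omits `0`.
    have hg : IsBoundedHolomorphic fun z => z * deriv σ z / σ z := by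
      refine isBoundedHolomorphic_of_eqOn (G := fun u => extWeight φ u / u) hK
        (hwc.div continuousOn_id fun u hu hu0 => h0 ?_) hσK hgd fun z hz => ?_
      · rwa [show u = 0 from hu0] at hu
      · rw [h.mul_deriv hz]
    obtain ⟨M, hM⟩ := hg.2
    obtain ⟨Mg, hMg, -⟩ := exists_multiplicationOp hgd hM
    refine ⟨hσ0, hg, Mg, hMg, isCompactOperator_of_summable
      (h.summable_norm_apply_monom hφ hreg hone hC fun n z hz => ?_)⟩
    -- The factor `1/σ` in `g` plays the role of `B`: it lowers `σ^(n+1)` to `σ^n`.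
    rw [ContinuousLinearMap.comp_apply, hMg _ z hz, hCσ _ z hz, monom_apply _ (hmaps hz),
      ← h.mul_deriv hz, pow_succ]
    have := hσ0 z hz
    field_simp
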